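/- Let $\mathcal X=\mathbb R^d$ and $\mathcal Y=\mathbb R^m$ carry the Euclidean norms, let $K:\mathcal X\to\mathcal Y$ be linear with operator norm $L=\|K\|$, and let $f:\mathcal Y\to\mathbb R\cup\{\infty\}$ and $g:\mathcal X\to\mathbb R\cup\{\infty\}$ be proper, convex and lower semicontinuous. Let $f^*$ be the convex conjugate of $f$, and write $\mathrm{prox}_{\gamma\phi}=(\mathrm{id}+\gamma\,\partial\phi)^{-1}$. Assume that $g$ is $\omega_g$-strongly convex and $f^*$ is $\omega_{f^*}$-strongly convex with $\omega_g,\omega_{f^*}>0$. Let $\tau,\sigma>0$, $\lambda=\sigma/\tau$, and let $\theta$ satisfy $$\max\{(1+2\omega_g\tau)^{-1},(1+2\omega_{f^*}\sigma)^{-1}\}\le\theta<1,\qquad \theta\sigma\tau L^2\le 1 .$$ Put $\tilde\lambda=\frac{1+2\omega_g\tau}{1+2\omega_{f^*}\sigma}\,\lambda$. A ULPDA chain with initial value $(X^0,Y^0)$ is defined by $X^0_\theta=X^0$ and, for $n\ge0$, $$Y^{n+1}=\mathrm{prox}_{\sigma f^*}(Y^n+\sigma KX^n_\theta),\quad X^{n+1}=\mathrm{prox}_{\tau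 g}(X^n-\tau K^TY^{n+1})+\sqrt{2\tau}\,\xi^{n+1},\quad X^{n+1}_\theta=X^{n+1}+\theta(X^{n+1}-X^n),$$ where $\xi^1,\xi^2,\dots$ are i.i.d. $\mathrm N(0,I_d)$ and independent of $(X^0,Y^0)$. Let $\pi_n$ be the law of $(X^n,Y^n)$ and $\mu_n$ the law of $X^n$. For probability measures $\pi,\tilde\pi$ on $\mathcal X\times\mathcal Y$ and $a,b>0$ let $$\mathcal T_{a,b}(\pi,\tilde\pi)=\inf_{M}\Big(\mathbb E_{((x,y),(\tilde x,\tilde y))\sim M}\big[a\|x-\tilde x\|^2+b\|y-\tilde y\|^2\big]\Big)^{1/2}\in[0,\infty],$$ the infimum being over all couplings $M$ of $\pi$ and $\tilde\pi$, and let $\mathcal W_2$ be the $2$-Wasserstein distance on $\mathcal X$, defined in the same way with cost $\|x-\tilde x\|^2$. (i) Let $(X^n,Y^n)$ and $(\tilde X^n,\tilde Y^n)$ be two ULPDA chains driven by the same noise $(\xi^n)$, with laws $\pi_n,\mu_n$ and $\tilde\pi_n,\tilde\mu_n$. Then for all $N\ge0$ $$\mathcal W_2(\mu_N,\tilde\mu_N)\le\theta^{N/2}\,\mathcal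 T_{1,\tilde\lambda^{-1}}(\pi_0,\tilde\pi_0).$$ (ii) If moreover $\theta\sigma\tau L^2<1$, then for all $N\ge0$ $$\mathcal T_{1,\tilde\lambda^{-1}}(\pi_N,\tilde\pi_N)\le(1-\theta\tau\sigma L^2)^{-1/2}\,\theta^{N/2}\,\mathcal T_{1,\tilde\lambda^{-1}}(\pi_0,\tilde\pi_0).$$ (iii) If $\theta\sigma\tau L^2<1$, then the Markov chain $(X^n,X^n_\theta,Y^n)$ has a stationary probability distribution whose $(x,y)$-marginal $\pi_{\lambda,\tau}$ has finite second moment, and for every ULPDA chain whose initial law $\pi_0$ has finite second moment, $\mathcal T_{1,\tilde\lambda^{-1}}(\pi_N,\pi_{\lambda,\tau})\to0$ as $N\to\infty$. -/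

import Mathlib

open MeasureTheory ProbabilityTheory Filter Topology
open scoped ENNReal

noncomputable section

namespace ULPDA

/-! ### Convex analysis for functions with values in `ℝ ∪ {∞}` -/

section Convex

variable {E : Type*} [NormedAddCommGroup E] [InnerProductSpace ℝ E]

/-- `φ` is `ω`-strongly convex:
`φ (a x + b y) + a b (ω / 2) ‖x - y‖² ≤ a φ x + b φ y` for `a, b ≥ 0`, `a + b = 1`. -/
def StronglyConvex (ω : ℝ) (φ : E → EReal) : Prop :=
  ∀ x y : E, ∀ a b : ℝ, 0 ≤ a → 0 ≤ b → a + b = 1 →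
    φ (a • x + b • y) + ((a * b * (ω / 2 * ‖x - y‖ ^ 2) : ℝ) : EReal)
      ≤ (a : EReal) * φ x + (b : EReal) * φ y

/-- A potential term: a proper, convex, lower semicontinuous function `E → ℝ ∪ {∞}`. -/
structure IsPotential (φ : E → EReal) : Prop where
  ne_bot : ∀ x, φ x ≠ ⊥
  proper : ∃ x, φ x ≠ ⊤
  convex : StronglyConvex 0 φ
  lsc : LowerSemicontinuous φ

/-- The convex conjugate `φ* y = sup_x (⟪x, y⟫ - φ x)`. -/
def conj (φ : E → EReal) (y : E) : EReal :=
  ⨆ x : E, ((inner ℝ x y : ℝ) : EReal) - φ x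

/-- The subdifferential `∂φ(x)`. -/
def subdiff (φ : E → EReal) (x : E) : Set E :=
  {p | φ x ≠ ⊤ ∧ ∀ w : E, φ x + ((inner ℝ p (w - x) : ℝ) : EReal) ≤ φ w}

/-- The proximal mapping `prox_{γφ}(z) = (id + γ ∂φ)⁻¹(z)`: the point `u` with
`z ∈ u + γ ∂φ(u)`. -/
def prox (γ : ℝ) (φ : E → EReal) (z : E) : E :=
  Classical.epsilon fun u : E => ∃ p ∈ subdiff φ u, u + γ • p = z

end Convex

/-! ### Transport distances -/

section Transport

variable {E : Type*} [MeasurableSpace E]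

/-- `M` is a coupling of `μ` and `ν`. -/
def IsCoupling (M : Measure (E × E)) (μ ν : Measure E) : Prop :=
  M.map Prod.fst = μ ∧ M.map Prod.snd = ν

/-- The transport distance `inf_M (E_{(x, x') ∼ M} [N(x - x')²])^{1/2}` induced by a norm `N`,
the infimum being over all couplings `M` of `μ` and `ν`; it may be infinite. -/
def transportDist [Sub E] (N : E → ℝ) (μ ν : Measure E) : ℝ≥0∞ :=
  ⨅ (M : Measure (E × E)) (_ : IsCoupling M μ ν),
    (∫⁻ p, ENNReal.ofReal (N (p.1 - p.2) ^ 2) ∂M) ^ (1 / 2 : ℝ)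

end Transport

/-- The 2-Wasserstein distance. -/
def W2 {E : Type*} [MeasurableSpace E] [NormedAddCommGroup E] (μ ν : Measure E) : ℝ≥0∞ :=
  transportDist (fun x : E => ‖x‖) μ ν

/-- The weighted norm `‖(x, y)‖_{a,b} = (a ‖x‖² + b ‖y‖²)^{1/2}` on a product. -/
def weightedNorm {E F : Type*} [NormedAddCommGroup E] [NormedAddCommGroup F]
    (a b : ℝ) (z : E × F) : ℝ :=
  √(a * ‖z.1‖ ^ 2 + b * ‖z.2‖ ^ 2)

/-- The transport distance `T_{a,b}` induced by `‖·‖_{a,b}`. -/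
def T {E F : Type*} [MeasurableSpace E] [NormedAddCommGroup E] [MeasurableSpace F]
    [NormedAddCommGroup F] (a b : ℝ) (μ ν : Measure (E × F)) : ℝ≥0∞ :=
  transportDist (weightedNorm a b) μ ν

/-! ### The unadjusted Langevin primal-dual algorithm -/

section Algorithm

variable {d m : ℕ}

/-- `(X n, Xθ n, Y n)` are the iterates of the algorithm driven by the noise `ξ`, where `ξ n` is
the standard Gaussian vector that enters the step from `n` to `n + 1`. The noise is i.i.d. and
independent of the initial value, and `Xθ 0 = X 0`. -/
structure IsChain (K : EuclideanSpace ℝ (Fin d) →L[ℝ] EuclideanSpace ℝ (Fin m))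
    (f : EuclideanSpace ℝ (Fin m) → EReal) (g : EuclideanSpace ℝ (Fin d) → EReal)
    (τ σ θ : ℝ) {Ω : Type*} [MeasurableSpace Ω] (P : Measure Ω)
    (ξ X Xθ : ℕ → Ω → EuclideanSpace ℝ (Fin d)) (Y : ℕ → Ω → EuclideanSpace ℝ (Fin m)) :
    Prop where
  measurable_X_zero : Measurable (X 0)
  measurable_Y_zero : Measurable (Y 0)
  measurable_noise : ∀ n, Measurable (ξ n)
  law_noise : ∀ n, P.map (ξ n) = stdGaussian (EuclideanSpace ℝ (Fin d))
  iIndep_noise : iIndepFun ξ P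
  indep_initial : IndepFun (fun ω => (X 0 ω, Y 0 ω)) (fun ω n => ξ n ω) P
  extrapolation_zero : ∀ ω, Xθ 0 ω = X 0 ω
  dual_step : ∀ n ω, Y (n + 1) ω = prox σ (conj f) (Y n ω + σ • K (Xθ n ω))
  primal_step : ∀ n ω, X (n + 1) ω =
    prox τ g (X n ω - τ • ContinuousLinearMap.adjoint K (Y (n + 1) ω)) + √(2 * τ) • ξ n ω
  extrapolation_step : ∀ n ω, Xθ (n + 1) ω = X (n + 1) ω + θ • (X (n + 1) ω - X n ω)

/-- One step of the algorithm: the next state as a function of the state `s = (x, x_θ, y)` and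
the noise `e`. -/
def step (K : EuclideanSpace ℝ (Fin d) →L[ℝ] EuclideanSpace ℝ (Fin m))
    (f : EuclideanSpace ℝ (Fin m) → EReal) (g : EuclideanSpace ℝ (Fin d) → EReal)
    (τ σ θ : ℝ)
    (s : EuclideanSpace ℝ (Fin d) × EuclideanSpace ℝ (Fin d) × EuclideanSpace ℝ (Fin m))
    (e : EuclideanSpace ℝ (Fin d)) :
    EuclideanSpace ℝ (Fin d) × EuclideanSpace ℝ (Fin d) × EuclideanSpace ℝ (Fin m) :=
  let y' := prox σ (conj f) (s.2.2 + σ • K s.2.1)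
  let x' := prox τ g (s.1 - τ • ContinuousLinearMap.adjoint K y') + √(2 * τ) • e
  (x', x' + θ • (x' - s.1), y')

/-- `S` is a stationary distribution of the Markov chain `(X^n, X_θ^n, Y^n)` of the algorithm:
a probability measure that one step with fresh Gaussian noise leaves invariant. -/
def IsStationary (K : EuclideanSpace ℝ (Fin d) →L[ℝ] EuclideanSpace ℝ (Fin m))
    (f : EuclideanSpace ℝ (Fin m) → EReal) (g : EuclideanSpace ℝ (Fin d) → EReal)
    (τ σ θ : ℝ)
    (S : Measure (EuclideanSpace ℝ (Fin d) × EuclideanSpace ℝ (Fin d) ×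
      EuclideanSpace ℝ (Fin m))) : Prop :=
  IsProbabilityMeasure S ∧
    (S.prod (stdGaussian (EuclideanSpace ℝ (Fin d)))).map
      (fun p => step K f g τ σ θ p.1 p.2) = S

end Algorithm

end ULPDA

end

namespace ULPDA

/-! ### Subgradients and proximal mappings -/

section Convex

/-! Two chains driven by the same noise have differences in which the noise cancels, so the
deterministic estimate for strongly convex primal-dual iterations applies. For a difference of
states with last increment `v` of the primal variable, the `energy` is a weighted square norm of
`(x, y)` plus `τ⁻¹ ‖v‖² + 2 ⟪K v, y⟫`. Strong monotonicity of the two proximal maps makes it shrink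
by `θ` in each step (`energy_recursion`, `energy_step_sub_le`).

Initially `v = 0`, so the energy is the transport cost up to a factor. Later, Young's inequality
bounds the indefinite cross term at the expense of a fraction `θστ‖K‖²` of the `y`-part. If this
fraction is at most `1`, the `x`-part survives, which gives (i); if it is below `1`, both parts
survive up to the factor `1 - θστ‖K‖²`, which gives (ii). Running an arbitrary initial coupling with
shared noise carries this over to laws (`transportDist_evolve_le`).

For (iii) the energy is equivalent to the squared norm of the full state. A stationary law arises as
the law of a fixed point, by Banach's theorem, of a map on square-integrable functions of an i.i.d.
noise sequence (`exists_stationary`). Convergence follows from the contraction estimate applied to a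
product coupling, which has finite energy. -/

theorem nonneg_of_forall_nonneg_add_mul {a c : ℝ} (h : ∀ t : ℝ, 0 < t → t ≤ 1 → 0 ≤ a + t * c) :
    0 ≤ a := by
  have hlim : Tendsto (fun t : ℝ => a + t * c) (𝓝[>] 0) (𝓝 a) := by
    have : Tendsto (fun t : ℝ => a + t * c) (𝓝 0) (𝓝 (a + 0 * c)) :=
      (by fun_prop : Continuous fun t : ℝ => a + t * c).tendsto 0
    simpa using this.mono_left nhdsWithin_le_nhds
  refine ge_of_tendsto hlim ?_
  filter_upwards [Ioc_mem_nhdsGT (zero_lt_one' ℝ)] with t ht using h t ht.1 ht.2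

variable {E : Type*} [NormedAddCommGroup E] [InnerProductSpace ℝ E] {φ : E → EReal} {ω γ : ℝ}

theorem StronglyConvex.exists_real_le (hφ : StronglyConvex ω φ) (hbot : ∀ x, φ x ≠ ⊥)
    {x y : E} {r s a b : ℝ} (hx : φ x = r) (hy : φ y = s) (ha : 0 ≤ a) (hb : 0 ≤ b)
    (hab : a + b = 1) :
    ∃ t : ℝ, φ (a • x + b • y) = t ∧ t + a * b * (ω / 2 * ‖x - y‖ ^ 2) ≤ a * r + b * s := by
  have h := hφ x y a b ha hb hab
  have hb' := hbot (a • x + b • y)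
  rw [hx, hy] at h
  generalize φ (a • x + b • y) = v at h hb'
  induction v with
  | bot => exact absurd rfl hb'
  | top =>
    rw [EReal.top_add_coe, top_le_iff] at h
    rw [← EReal.coe_mul, ← EReal.coe_mul, ← EReal.coe_add] at h
    exact absurd h (EReal.coe_ne_top _)
  | coe t => exact ⟨t, rfl, by exact_mod_cast h⟩

theorem StronglyConvex.mono (hφ : StronglyConvex ω φ) {ω' : ℝ} (h : ω' ≤ ω) :
    StronglyConvex ω' φ := by
  intro x y a b ha hb hab
  refine le_trans ?_ (hφ x y a b ha hb hab)
  gcongr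

/-- Test the subgradient inequality at `(1 - t) x + t w`, bound the value there by strong convexity,
divide by `t` and let `t → 0`. -/
theorem StronglyConvex.add_le_of_mem_subdiff (hφ : StronglyConvex ω φ) (hbot : ∀ x, φ x ≠ ⊥)
    {x w p : E} {r s : ℝ} (hx : φ x = r) (hw : φ w = s) (hp : p ∈ subdiff φ x) :
    r + inner ℝ p (w - x) + ω / 2 * ‖w - x‖ ^ 2 ≤ s := by
  suffices h : 0 ≤ s - r - inner ℝ p (w - x) - ω / 2 * ‖w - x‖ ^ 2 by linarith
  refine nonneg_of_forall_nonneg_add_mul (c := ω / 2 * ‖w - x‖ ^ 2) fun t ht ht1 => ?_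
  obtain ⟨v, hv, hle⟩ := hφ.exists_real_le hbot hx hw (sub_nonneg.2 ht1) ht.le (by ring)
  have hsub := hp.2 ((1 - t) • x + t • w)
  have hdir : (1 - t) • x + t • w - x = t • (w - x) := by module
  rw [hv, hx, hdir, inner_smul_right, ← EReal.coe_add, EReal.coe_le_coe_iff] at hsub
  rw [norm_sub_rev] at hle
  have : 0 ≤ t * (s - r - inner ℝ p (w - x) - ω / 2 * ‖w - x‖ ^ 2
      + t * (ω / 2 * ‖w - x‖ ^ 2)) := by nlinarith
  exact nonneg_of_mul_nonneg_right this ht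

theorem exists_real_of_mem_subdiff (hbot : ∀ x, φ x ≠ ⊥) {x p : E} (hp : p ∈ subdiff φ x) :
    ∃ r : ℝ, φ x = r :=
  ⟨(φ x).toReal, (EReal.coe_toReal hp.1 (hbot x)).symm⟩

/-- Add the two subgradient inequalities with the points exchanged; the two halves `ω / 2` combine
to `ω`. -/
theorem StronglyConvex.mul_sq_le_inner (hφ : StronglyConvex ω φ) (hbot : ∀ x, φ x ≠ ⊥)
    {x x' p p' : E} (hp : p ∈ subdiff φ x) (hp' : p' ∈ subdiff φ x') :
    ω * ‖x - x'‖ ^ 2 ≤ inner ℝ (p - p') (x - x') := by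
  obtain ⟨r, hr⟩ := exists_real_of_mem_subdiff hbot hp
  obtain ⟨r', hr'⟩ := exists_real_of_mem_subdiff hbot hp'
  have h1 := hφ.add_le_of_mem_subdiff hbot hr hr' hp
  have h2 := hφ.add_le_of_mem_subdiff hbot hr' hr hp'
  rw [← neg_sub x x', inner_neg_right, norm_neg] at h1
  rw [inner_sub_left]
  linarith

variable [FiniteDimensional ℝ E]

/-- A potential decreases at most linearly away from a point of its domain. -/
theorem IsPotential.exists_linear_lower_bound (hφ : IsPotential φ) {x₀ : E} {r₀ : ℝ}
    (h₀ : φ x₀ = r₀) :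
    ∃ C : ℝ, 0 ≤ C ∧ ∀ x, ((-(C * (1 + ‖x - x₀‖)) : ℝ) : EReal) ≤ φ x := by
  have : ProperSpace E := FiniteDimensional.proper ℝ E
  obtain ⟨c, -, hmin⟩ := (hφ.lsc.lowerSemicontinuousOn _).exists_isMinOn
    ⟨x₀, Metric.mem_closedBall_self zero_le_one⟩ (isCompact_closedBall x₀ 1)
  have hcle : φ c ≤ r₀ := h₀ ▸ hmin (Metric.mem_closedBall_self zero_le_one)
  obtain ⟨r, hr⟩ : ∃ r : ℝ, φ c = r :=
    ⟨_, (EReal.coe_toReal (ne_top_of_le_ne_top (EReal.coe_ne_top _) hcle) (hφ.ne_bot c)).symm⟩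
  refine ⟨|r| + |r₀|, by positivity, fun x => ?_⟩
  rcases le_or_gt ‖x - x₀‖ 1 with hx | hx
  · have h1 : φ c ≤ φ x := hmin (by simpa [dist_eq_norm] using hx)
    refine le_trans ?_ h1
    rw [hr, EReal.coe_le_coe_iff]
    have h2 := neg_abs_le r
    have h3 : 0 ≤ (|r| + |r₀|) * ‖x - x₀‖ := by positivity
    have h4 := abs_nonneg r₀
    linarith
  · by_cases htop : φ x = ⊤
    · simp [htop]
    obtain ⟨s, hs⟩ : ∃ s : ℝ, φ x = s := ⟨_, (EReal.coe_toReal htop (hφ.ne_bot x)).symm⟩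
    set D := ‖x - x₀‖
    have hD : 0 < D := by linarith
    have hD1 : D⁻¹ ≤ 1 := inv_le_one_of_one_le₀ hx.le
    obtain ⟨v, hv, hle⟩ := hφ.convex.exists_real_le hφ.ne_bot h₀ hs
      (sub_nonneg.2 hD1) (inv_nonneg.2 hD.le) (by ring)
    -- The segment from `x₀` to `x` meets the unit sphere around `x₀` here. Convexity along it turns
    -- the minimum over the ball into a linear lower bound at `x`, with no separation argument.
    have hball : (1 - D⁻¹) • x₀ + D⁻¹ • x ∈ Metric.closedBall x₀ 1 := by
      rw [Metric.mem_closedBall, dist_eq_norm,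
        show (1 - D⁻¹) • x₀ + D⁻¹ • x - x₀ = D⁻¹ • (x - x₀) by module, norm_smul, norm_inv,
        norm_norm, inv_mul_cancel₀ hD.ne']
    have hrv : φ c ≤ φ ((1 - D⁻¹) • x₀ + D⁻¹ • x) := hmin hball
    rw [hr, hv, EReal.coe_le_coe_iff] at hrv
    rw [hs, EReal.coe_le_coe_iff]
    have h1 : D * r ≤ (D - 1) * r₀ + s := by
      calc D * r ≤ D * ((1 - D⁻¹) * r₀ + D⁻¹ * s) := by
            refine mul_le_mul_of_nonneg_left ?_ hD.le
            linarith
        _ = (D - 1) * r₀ + s := by field_simp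
    have h2 := mul_le_mul_of_nonneg_left (neg_abs_le r) hD.le
    have h3 := mul_le_mul_of_nonneg_left (le_abs_self r₀) (sub_nonneg.2 hx.le)
    have h4 := abs_nonneg r
    have h5 := abs_nonneg r₀
    nlinarith

theorem IsPotential.exists_isMinOn_add_sq (hφ : IsPotential φ) (hγ : 0 < γ) (z : E) :
    ∃ u, ∀ w, φ u + ((‖u - z‖ ^ 2 / (2 * γ) : ℝ) : EReal)
      ≤ φ w + ((‖w - z‖ ^ 2 / (2 * γ) : ℝ) : EReal) := by
  have : ProperSpace E := FiniteDimensional.proper ℝ E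
  obtain ⟨x₀, hx₀⟩ := hφ.proper
  obtain ⟨r₀, h₀⟩ : ∃ r : ℝ, φ x₀ = r := ⟨_, (EReal.coe_toReal hx₀ (hφ.ne_bot x₀)).symm⟩
  obtain ⟨C, hC, hlow⟩ := hφ.exists_linear_lower_bound h₀
  have hlsc : LowerSemicontinuous fun u => φ u + ((‖u - z‖ ^ 2 / (2 * γ) : ℝ) : EReal) := by
    refine hφ.lsc.add' ?_ fun u => ?_
    · exact (continuous_coe_real_ereal.comp (by fun_prop)).lowerSemicontinuous
    · exact EReal.continuousAt_add (Or.inr (EReal.coe_ne_bot _)) (Or.inr (EReal.coe_ne_top _))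
  set k := ‖x₀ - z‖
  -- Beyond this radius the quadratic term outweighs the linear lower bound of `φ`, so no point
  -- outside the ball beats `x₀`. The summand `1` ensures `D ≥ 1`, which absorbs the constants into
  -- multiples of `D`.
  set R := 1 + (2 * k + 2 * γ * (2 * C + |r₀|)) with hR
  have hR0 : 1 ≤ R := by
    rw [hR]
    have : 0 ≤ 2 * k + 2 * γ * (2 * C + |r₀|) := by positivity
    linarith
  have hmem : x₀ ∈ Metric.closedBall x₀ R := Metric.mem_closedBall_self (by linarith)
  obtain ⟨u, -, hmin⟩ := (hlsc.lowerSemicontinuousOn _).exists_isMinOn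
    ⟨x₀, hmem⟩ (isCompact_closedBall x₀ R)
  refine ⟨u, fun w => ?_⟩
  by_cases hw : w ∈ Metric.closedBall x₀ R
  · exact hmin hw
  refine le_trans (hmin hmem) ?_
  simp only
  refine le_trans ?_ (add_le_add_left (hlow w) _)
  rw [h₀, ← EReal.coe_add, ← EReal.coe_add, EReal.coe_le_coe_iff]
  rw [Metric.mem_closedBall, dist_eq_norm, not_le] at hw
  set D := ‖w - x₀‖
  have htri : D ≤ ‖w - z‖ + k := by
    have := norm_sub_le (w - z) (x₀ - z)
    rwa [sub_sub_sub_cancel_right] at this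
  have hk : 0 ≤ k := norm_nonneg _
  have hr := le_abs_self r₀
  have hr' := abs_nonneg r₀
  have hDk : 0 ≤ D - k := by
    have : 0 ≤ 2 * γ * (2 * C + |r₀|) := by positivity
    linarith
  have hsq : (D - k) ^ 2 ≤ ‖w - z‖ ^ 2 := pow_le_pow_left₀ hDk (by linarith) 2
  have hmain : 2 * γ * (r₀ + C * (1 + D)) + k ^ 2 ≤ (D - k) ^ 2 := by
    have h1 : D * (2 * γ * (2 * C + |r₀|)) ≤ D * (D - 2 * k) := by
      refine mul_le_mul_of_nonneg_left ?_ (by linarith)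
      linarith
    have h2 : C + r₀ ≤ D * (C + |r₀|) := by nlinarith
    have h3 := mul_le_mul_of_nonneg_left h2 (by positivity : 0 ≤ 2 * γ)
    nlinarith
  have : r₀ + C * (1 + D) + k ^ 2 / (2 * γ) ≤ ‖w - z‖ ^ 2 / (2 * γ) := by
    rw [le_div_iff₀ (by positivity)]
    calc (r₀ + C * (1 + D) + k ^ 2 / (2 * γ)) * (2 * γ)
        = 2 * γ * (r₀ + C * (1 + D)) + k ^ 2 := by field_simp
      _ ≤ _ := hmain.trans hsq
  linarith

/-- Fermat's rule: a minimiser `u` of `φ + ‖· - z‖² / (2γ)` has the subgradient `γ⁻¹ (z - u)`, as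
seen by moving a distance `t` towards `w` and letting `t → 0`. -/
theorem IsPotential.exists_mem_subdiff (hφ : IsPotential φ) (hγ : 0 < γ) (z : E) :
    ∃ u, ∃ p ∈ subdiff φ u, u + γ • p = z := by
  obtain ⟨u, hu⟩ := hφ.exists_isMinOn_add_sq hγ z
  obtain ⟨x₀, hx₀⟩ := hφ.proper
  have htop : φ u ≠ ⊤ := by
    intro h
    have := hu x₀
    rw [h, EReal.top_add_coe, top_le_iff] at this
    exact (EReal.add_ne_top hx₀ (EReal.coe_ne_top _)) this
  obtain ⟨r, hr⟩ : ∃ r : ℝ, φ u = r := ⟨_, (EReal.coe_toReal htop (hφ.ne_bot u)).symm⟩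
  refine ⟨u, γ⁻¹ • (z - u), ⟨htop, fun w => ?_⟩, by
    rw [smul_inv_smul₀ hγ.ne', add_sub_cancel]⟩
  by_cases hwt : φ w = ⊤
  · simp [hwt]
  obtain ⟨s, hs⟩ : ∃ s : ℝ, φ w = s := ⟨_, (EReal.coe_toReal hwt (hφ.ne_bot w)).symm⟩
  rw [hr, hs, ← EReal.coe_add, EReal.coe_le_coe_iff]
  suffices h : 0 ≤ s - r - inner ℝ (γ⁻¹ • (z - u)) (w - u) by linarith
  refine nonneg_of_forall_nonneg_add_mul (c := ‖w - u‖ ^ 2 / (2 * γ)) fun t ht ht1 => ?_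
  obtain ⟨v, hv, hle⟩ := hφ.convex.exists_real_le hφ.ne_bot hr hs (sub_nonneg.2 ht1) ht.le
    (by ring)
  have hmin := hu ((1 - t) • u + t • w)
  rw [hv, hr, ← EReal.coe_add, ← EReal.coe_add, EReal.coe_le_coe_iff,
    show (1 - t) • u + t • w - z = t • (w - u) - (z - u) by module,
    norm_sub_sq_real (t • (w - u)),
    norm_sub_rev u z, norm_smul, inner_smul_left, mul_pow, Real.norm_eq_abs, sq_abs] at hmin
  rw [inner_smul_left, real_inner_comm]
  simp only [conj_trivial] at hmin ⊢
  refine nonneg_of_mul_nonneg_right ?_ ht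
  have : t * (s - r - γ⁻¹ * inner ℝ (w - u) (z - u) + t * (‖w - u‖ ^ 2 / (2 * γ)))
      = ((1 - t) * r + t * s - v) + (v + (t ^ 2 * ‖w - u‖ ^ 2 -
        2 * (t * inner ℝ (w - u) (z - u)) + ‖z - u‖ ^ 2) / (2 * γ)
        - (r + ‖z - u‖ ^ 2 / (2 * γ))) := by
    field_simp
    ring
  rw [this]
  have h0 : (1 - t) * t * (0 / 2 * ‖u - w‖ ^ 2) = 0 := by ring
  linarith

theorem IsPotential.prox_spec (hφ : IsPotential φ) (hγ : 0 < γ) (z : E) :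
    ∃ p ∈ subdiff φ (prox γ φ z), prox γ φ z + γ • p = z :=
  Classical.epsilon_spec (hφ.exists_mem_subdiff hγ z)

/-- The resolvent form of strong monotonicity of `∂φ`. It is the only property of the proximal maps
that enters the energy estimate. -/
theorem IsPotential.mul_sq_prox_sub_le (hφ : IsPotential φ) (hs : StronglyConvex ω φ)
    (hγ : 0 < γ) (z z' : E) :
    (1 + γ * ω) * ‖prox γ φ z - prox γ φ z'‖ ^ 2 ≤
      inner ℝ (z - z') (prox γ φ z - prox γ φ z') := by
  obtain ⟨p, hp, hz⟩ := hφ.prox_spec hγ z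
  obtain ⟨p', hp', hz'⟩ := hφ.prox_spec hγ z'
  have h := hs.mul_sq_le_inner hφ.ne_bot hp hp'
  generalize prox γ φ z = u at *
  generalize prox γ φ z' = u' at *
  rw [← hz, ← hz', show u + γ • p - (u' + γ • p') = (u - u') + γ • (p - p') by module,
    inner_add_left, inner_smul_left, real_inner_self_eq_norm_sq]
  simp only [conj_trivial]
  nlinarith

theorem IsPotential.lipschitzWith_prox (hφ : IsPotential φ) (hγ : 0 < γ) :
    LipschitzWith 1 (prox γ φ) := by
  refine LipschitzWith.of_dist_le_mul fun z z' => ?_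
  have h := hφ.mul_sq_prox_sub_le hφ.convex hγ z z'
  have h2 := real_inner_le_norm (z - z') (prox γ φ z - prox γ φ z')
  rw [NNReal.coe_one, one_mul, dist_eq_norm, dist_eq_norm]
  have h0 := norm_nonneg (prox γ φ z - prox γ φ z')
  by_contra! hlt
  nlinarith [norm_nonneg (z - z')]

/-- A subgradient of `φ` at `u` is a point where the conjugate is finite, by the equality case of
Fenchel–Young; lower semicontinuity holds because the conjugate is a supremum of continuous affine
functions and constants. -/
theorem IsPotential.conj (hφ : IsPotential φ) (hconv : StronglyConvex 0 (conj φ)) :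
    IsPotential (conj φ) where
  ne_bot y := by
    obtain ⟨x, hx⟩ := hφ.proper
    obtain ⟨r, hr⟩ : ∃ r : ℝ, φ x = r := ⟨_, (EReal.coe_toReal hx (hφ.ne_bot x)).symm⟩
    refine ne_bot_of_le_ne_bot (b := ((inner ℝ x y : ℝ) : EReal) - φ x) ?_
      (le_iSup (fun x : E => ((inner ℝ x y : ℝ) : EReal) - φ x) x)
    rw [hr, ← EReal.coe_sub]
    exact EReal.coe_ne_bot _
  proper := by
    obtain ⟨u, p, hp, -⟩ := hφ.exists_mem_subdiff one_pos 0
    obtain ⟨r, hr⟩ := exists_real_of_mem_subdiff hφ.ne_bot hp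
    refine ⟨p, ne_top_of_le_ne_top (EReal.coe_ne_top (inner ℝ u p - r)) (iSup_le fun w => ?_)⟩
    by_cases hwt : φ w = ⊤
    · simp [hwt]
    obtain ⟨s, hs⟩ : ∃ s : ℝ, φ w = s := ⟨_, (EReal.coe_toReal hwt (hφ.ne_bot w)).symm⟩
    have h := hp.2 w
    rw [hr, hs, ← EReal.coe_add, EReal.coe_le_coe_iff, inner_sub_right, real_inner_comm,
      real_inner_comm u] at h
    rw [hs, ← EReal.coe_sub, EReal.coe_le_coe_iff]
    linarith
  convex := hconv
  lsc := by
    refine lowerSemicontinuous_iSup fun x => ?_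
    by_cases hxt : φ x = ⊤
    · simpa [hxt] using lowerSemicontinuous_const
    obtain ⟨r, hr⟩ : ∃ r : ℝ, φ x = r := ⟨_, (EReal.coe_toReal hxt (hφ.ne_bot x)).symm⟩
    simp only [hr, ← EReal.coe_sub]
    exact (continuous_coe_real_ereal.comp (by fun_prop)).lowerSemicontinuous

end Convex

/-! ### The Lyapunov function -/

section Energy

variable {E F : Type*} [NormedAddCommGroup E] [InnerProductSpace ℝ E]
  [NormedAddCommGroup F] [InnerProductSpace ℝ F] {K : E →L[ℝ] F} {ωg ωf τ σ θ : ℝ}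

/-- The Lyapunov function of the algorithm, evaluated at the difference `s = (x, x_θ, y)` of two
states; `θ⁻¹ • (x_θ - x)` stands for the increment of `x` in the previous step. -/
noncomputable def energy (K : E →L[ℝ] F) (ωg ωf τ σ θ : ℝ) (s : E × E × F) : ℝ :=
  (τ⁻¹ + 2 * ωg) * ‖s.1‖ ^ 2 + (σ⁻¹ + 2 * ωf) * ‖s.2.2‖ ^ 2
    + τ⁻¹ * ‖θ⁻¹ • (s.2.1 - s.1)‖ ^ 2 + 2 * inner ℝ (K (θ⁻¹ • (s.2.1 - s.1))) s.2.2

theorem continuous_energy : Continuous (energy K ωg ωf τ σ θ) := by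
  unfold energy
  fun_prop

/-- Completing the square: `p` times the form dominates `(p ‖v‖ - ‖K‖ ‖y‖)²`, up to the discriminant
term. -/
theorem quadratic_nonneg {p q : ℝ} (hp : 0 < p) (hpq : ‖K‖ ^ 2 ≤ p * q) (v : E) (y : F) :
    0 ≤ p * ‖v‖ ^ 2 + 2 * inner ℝ (K v) y + q * ‖y‖ ^ 2 := by
  have h1 : -(‖K‖ * ‖v‖ * ‖y‖) ≤ inner ℝ (K v) y := by
    have h := neg_le_of_abs_le (abs_real_inner_le_norm (K v) y)
    have h' := mul_le_mul_of_nonneg_right (K.le_opNorm v) (norm_nonneg y)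
    linarith
  suffices h : 0 ≤ p * ‖v‖ ^ 2 - 2 * (‖K‖ * ‖v‖ * ‖y‖) + q * ‖y‖ ^ 2 by linarith
  refine nonneg_of_mul_nonneg_right ?_ hp
  have h2 := mul_nonneg (sub_nonneg.2 hpq) (sq_nonneg ‖y‖)
  nlinarith [sq_nonneg (p * ‖v‖ - ‖K‖ * ‖y‖)]

theorem energy_recursion [CompleteSpace E] [CompleteSpace F]
    (hτ : 0 < τ) (hσ : 0 < σ) (hθ0 : 0 < θ)
    (hθg : τ⁻¹ ≤ θ * (τ⁻¹ + 2 * ωg)) (hθf : σ⁻¹ ≤ θ * (σ⁻¹ + 2 * ωf))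
    (hstep : θ * σ * τ * ‖K‖ ^ 2 ≤ 1) {x x' v : E} {y y' : F}
    (hx : (1 + τ * ωg) * ‖x'‖ ^ 2 ≤ inner ℝ (x - τ • ContinuousLinearMap.adjoint K y') x')
    (hy : (1 + σ * ωf) * ‖y'‖ ^ 2 ≤ inner ℝ (y + σ • K (x + θ • v)) y') :
    (τ⁻¹ + 2 * ωg) * ‖x'‖ ^ 2 + (σ⁻¹ + 2 * ωf) * ‖y'‖ ^ 2 + τ⁻¹ * ‖x' - x‖ ^ 2
        + 2 * inner ℝ (K (x' - x)) y' ≤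
      θ * ((τ⁻¹ + 2 * ωg) * ‖x‖ ^ 2 + (σ⁻¹ + 2 * ωf) * ‖y‖ ^ 2 + τ⁻¹ * ‖v‖ ^ 2
        + 2 * inner ℝ (K v) y) := by
  -- The proximal inequality times `2 / τ`, with `2 ⟪x, x'⟫` polarised.
  have hx2 : (τ⁻¹ + 2 * ωg) * ‖x'‖ ^ 2 + τ⁻¹ * ‖x' - x‖ ^ 2 + 2 * inner ℝ (K x') y'
      ≤ τ⁻¹ * ‖x‖ ^ 2 := by
    have h := mul_le_mul_of_nonneg_left hx (inv_nonneg.2 hτ.le)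
    rw [inner_sub_left, inner_smul_left, ContinuousLinearMap.adjoint_inner_left,
      real_inner_comm (K x')] at h
    simp only [conj_trivial] at h
    rw [norm_sub_sq_real, real_inner_comm x x']
    have e1 : τ⁻¹ * ((1 + τ * ωg) * ‖x'‖ ^ 2) = (τ⁻¹ + ωg) * ‖x'‖ ^ 2 := by field_simp
    have e2 : τ⁻¹ * (inner ℝ x x' - τ * inner ℝ (K x') y')
        = τ⁻¹ * inner ℝ x x' - inner ℝ (K x') y' := by field_simp
    rw [e1, e2] at h
    linarith
  have hy2 : (σ⁻¹ + 2 * ωf) * ‖y'‖ ^ 2 + σ⁻¹ * ‖y' - y‖ ^ 2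
      ≤ σ⁻¹ * ‖y‖ ^ 2 + 2 * inner ℝ (K x) y' + 2 * (θ * inner ℝ (K v) y') := by
    have h := mul_le_mul_of_nonneg_left hy (inv_nonneg.2 hσ.le)
    rw [inner_add_left, inner_smul_left, map_add, map_smul, inner_add_left, inner_smul_left] at h
    simp only [conj_trivial] at h
    rw [norm_sub_sq_real, real_inner_comm y y']
    have e1 : σ⁻¹ * ((1 + σ * ωf) * ‖y'‖ ^ 2) = (σ⁻¹ + ωf) * ‖y'‖ ^ 2 := by field_simp
    have e2 : σ⁻¹ * (inner ℝ y y' + σ * (inner ℝ (K x) y' + θ * inner ℝ (K v) y'))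
        = σ⁻¹ * inner ℝ y y' + (inner ℝ (K x) y' + θ * inner ℝ (K v) y') := by field_simp
    rw [e1, e2] at h
    linarith
  -- The extrapolated coupling acts on `y'`, whereas the old energy contains `⟪K v, y⟫`. The step
  -- size condition is what lets the discrepancy be absorbed by `σ⁻¹ ‖y' - y‖²` and `θ` times the
  -- old increment term.
  have hyoung : 2 * (θ * (inner ℝ (K v) y' - inner ℝ (K v) y))
      ≤ σ⁻¹ * ‖y' - y‖ ^ 2 + θ * (τ⁻¹ * ‖v‖ ^ 2) := by
    have h := quadratic_nonneg (K := K) (p := τ⁻¹) (q := (θ * σ)⁻¹) (by positivity) (by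
      calc ‖K‖ ^ 2 = (θ * σ * τ * ‖K‖ ^ 2) * (τ⁻¹ * (θ * σ)⁻¹) := by field_simp
        _ ≤ 1 * (τ⁻¹ * (θ * σ)⁻¹) := by gcongr
        _ = τ⁻¹ * (θ * σ)⁻¹ := one_mul _) v (-(y' - y))
    rw [norm_neg, inner_neg_right, inner_sub_right] at h
    have h' := mul_nonneg hθ0.le h
    have e : θ * ((θ * σ)⁻¹ * ‖y' - y‖ ^ 2) = σ⁻¹ * ‖y' - y‖ ^ 2 := by field_simp
    linarith
  have h1 := mul_le_mul_of_nonneg_right hθg (sq_nonneg ‖x‖)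
  have h2 := mul_le_mul_of_nonneg_right hθf (sq_nonneg ‖y‖)
  rw [map_sub, inner_sub_left]
  linarith

/-- The discriminant condition that controls the cross term by `τ⁻¹ ‖v‖²` and the fraction `θστ‖K‖²`
of the `y`-part of the energy; it amounts to `θσ(σ⁻¹ + 2ωf) ≥ 1`. -/
theorem norm_sq_le_of_step (hτ : 0 < τ) (hσ : 0 < σ) (hθ0 : 0 < θ)
    (hθf : σ⁻¹ ≤ θ * (σ⁻¹ + 2 * ωf)) :
    ‖K‖ ^ 2 ≤ τ⁻¹ * (θ * σ * τ * ‖K‖ ^ 2 * (σ⁻¹ + 2 * ωf)) := by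
  calc ‖K‖ ^ 2 = σ * ‖K‖ ^ 2 * σ⁻¹ := by field_simp
    _ ≤ σ * ‖K‖ ^ 2 * (θ * (σ⁻¹ + 2 * ωf)) := by gcongr
    _ = _ := by field_simp

theorem mul_le_energy (hωg : 0 < ωg) (hτ : 0 < τ) (hσ : 0 < σ) (hθ0 : 0 < θ)
    (hθf : σ⁻¹ ≤ θ * (σ⁻¹ + 2 * ωf)) (s : E × E × F) :
    (1 - θ * σ * τ * ‖K‖ ^ 2) *
      ((τ⁻¹ + 2 * ωg) * ‖s.1‖ ^ 2 + (σ⁻¹ + 2 * ωf) * ‖s.2.2‖ ^ 2) ≤ energy K ωg ωf τ σ θ s := by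
  have h := quadratic_nonneg (inv_pos.2 hτ) (norm_sq_le_of_step (K := K) hτ hσ hθ0 hθf)
    (θ⁻¹ • (s.2.1 - s.1)) s.2.2
  have h2 : 0 ≤ θ * σ * τ * ‖K‖ ^ 2 * ((τ⁻¹ + 2 * ωg) * ‖s.1‖ ^ 2) := by positivity
  unfold energy
  linarith

theorem mul_norm_fst_le_energy (hωf : 0 < ωf) (hτ : 0 < τ) (hσ : 0 < σ) (hθ0 : 0 < θ)
    (hθf : σ⁻¹ ≤ θ * (σ⁻¹ + 2 * ωf)) (hstep : θ * σ * τ * ‖K‖ ^ 2 ≤ 1) (s : E × E × F) :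
    (τ⁻¹ + 2 * ωg) * ‖s.1‖ ^ 2 ≤ energy K ωg ωf τ σ θ s := by
  have h := quadratic_nonneg (inv_pos.2 hτ) (norm_sq_le_of_step (K := K) hτ hσ hθ0 hθf)
    (θ⁻¹ • (s.2.1 - s.1)) s.2.2
  have h2 : θ * σ * τ * ‖K‖ ^ 2 * ((σ⁻¹ + 2 * ωf) * ‖s.2.2‖ ^ 2)
      ≤ 1 * ((σ⁻¹ + 2 * ωf) * ‖s.2.2‖ ^ 2) := by gcongr
  unfold energy
  linarith

theorem energy_diag (x : E) (y : F) :
    energy K ωg ωf τ σ θ (x, x, y) = (τ⁻¹ + 2 * ωg) * ‖x‖ ^ 2 + (σ⁻¹ + 2 * ωf) * ‖y‖ ^ 2 := by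
  simp [energy]

theorem exists_mul_norm_sq_le_energy (hωg : 0 < ωg) (hωf : 0 < ωf) (hτ : 0 < τ) (hσ : 0 < σ)
    (hθ0 : 0 < θ) (hθ1 : θ < 1)
    (hθf : σ⁻¹ ≤ θ * (σ⁻¹ + 2 * ωf)) (hstep : θ * σ * τ * ‖K‖ ^ 2 < 1) :
    ∃ c : ℝ, 0 < c ∧ ∀ s : E × E × F, c * ‖s‖ ^ 2 ≤ energy K ωg ωf τ σ θ s := by
  have hK := norm_sq_le_of_step (K := K) hτ hσ hθ0 hθf
  set κ := θ * σ * τ * ‖K‖ ^ 2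
  have hκ : 0 ≤ κ := by positivity
  set a := τ⁻¹ + 2 * ωg with ha
  set b := σ⁻¹ + 2 * ωf with hb
  have ha0 : 0 < a := by positivity
  have hb0 : 0 < b := by positivity
  -- A share `ε` of the `v`- and `y`-terms is kept for coercivity. The rest still controls the cross
  -- term because `(1 - ε)² = ((1 + κ) / 2)² ≥ κ`.
  set ε := (1 - κ) / 2 with hε
  have hε0 : 0 < ε := by rw [hε]; linarith
  set c := min a (min (ε * b) (ε * τ⁻¹)) with hc
  have hc0 : 0 < c := by positivity
  refine ⟨c / 2, by positivity, fun s => ?_⟩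
  set v := θ⁻¹ • (s.2.1 - s.1) with hv
  have hquad := quadratic_nonneg (K := K) (p := (1 - ε) * τ⁻¹) (q := (1 - ε) * b)
    (mul_pos (by linarith) (inv_pos.2 hτ)) (by
      refine hK.trans ?_
      calc τ⁻¹ * (κ * b) = κ * (τ⁻¹ * b) := by ring
        _ ≤ (1 - ε) ^ 2 * (τ⁻¹ * b) := by
          gcongr
          rw [hε]
          nlinarith [sq_nonneg (1 - κ)]
        _ = _ := by ring) v s.2.2
  have h1 : c * ‖s.1‖ ^ 2 ≤ a * ‖s.1‖ ^ 2 := by gcongr; exact min_le_left _ _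
  have h2 : c * ‖s.2.2‖ ^ 2 ≤ ε * b * ‖s.2.2‖ ^ 2 := by
    gcongr; exact (min_le_right _ _).trans (min_le_left _ _)
  have h3 : c * ‖v‖ ^ 2 ≤ ε * τ⁻¹ * ‖v‖ ^ 2 := by
    gcongr; exact (min_le_right _ _).trans (min_le_right _ _)
  have h4 : c * (‖s.1‖ ^ 2 + ‖v‖ ^ 2 + ‖s.2.2‖ ^ 2) ≤ energy K ωg ωf τ σ θ s := by
    rw [energy, ← hv, ← ha, ← hb]
    linarith
  refine le_trans ?_ h4
  have h5 : ‖s.2.1‖ ≤ ‖s.1‖ + ‖v‖ := by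
    have e : s.2.1 = s.1 + θ • v := by rw [hv, smul_inv_smul₀ hθ0.ne', add_sub_cancel]
    rw [e]
    refine (norm_add_le _ _).trans ?_
    rw [norm_smul, Real.norm_of_nonneg hθ0.le]
    have := mul_le_of_le_one_left (norm_nonneg v) hθ1.le
    linarith
  have h6 : ‖s.2.1‖ ^ 2 ≤ 2 * (‖s.1‖ ^ 2 + ‖v‖ ^ 2) := by
    nlinarith [sq_nonneg (‖s.1‖ - ‖v‖), norm_nonneg s.2.1]
  have h7 : ‖s‖ ^ 2 ≤ 2 * (‖s.1‖ ^ 2 + ‖v‖ ^ 2 + ‖s.2.2‖ ^ 2) := by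
    rw [Prod.norm_def, Prod.norm_def]
    have h8 := sq_nonneg ‖s.1‖
    have h9 := sq_nonneg ‖v‖
    have h10 := sq_nonneg ‖s.2.2‖
    rcases max_choice ‖s.1‖ (max ‖s.2.1‖ ‖s.2.2‖) with h | h <;> rw [h]
    · linarith
    rcases max_choice ‖s.2.1‖ ‖s.2.2‖ with h | h <;> rw [h]
    · linarith
    · linarith
  linarith [mul_le_mul_of_nonneg_left h7 hc0.le]

theorem exists_energy_le_mul_norm_sq (hωg : 0 < ωg) (hωf : 0 < ωf) (hτ : 0 < τ) (hσ : 0 < σ)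
    (hθ0 : 0 < θ) :
    ∃ C : ℝ, 0 < C ∧ ∀ s : E × E × F, energy K ωg ωf τ σ θ s ≤ C * ‖s‖ ^ 2 := by
  refine ⟨(τ⁻¹ + 2 * ωg) + (σ⁻¹ + 2 * ωf) + τ⁻¹ * (θ⁻¹ * 2) ^ 2 + 2 * (‖K‖ * (θ⁻¹ * 2)),
    by positivity, fun s => ?_⟩
  have h1 : ‖s.1‖ ≤ ‖s‖ := norm_fst_le s
  have h2 : ‖s.2.2‖ ≤ ‖s‖ := (norm_snd_le s.2).trans (norm_snd_le s)
  have h3 : ‖s.2.1‖ ≤ ‖s‖ := (norm_fst_le s.2).trans (norm_snd_le s)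
  have h4 : ‖θ⁻¹ • (s.2.1 - s.1)‖ ≤ θ⁻¹ * 2 * ‖s‖ := by
    rw [norm_smul, Real.norm_of_nonneg (inv_nonneg.2 hθ0.le), mul_assoc]
    gcongr
    exact (norm_sub_le _ _).trans (by linarith)
  have h5 : inner ℝ (K (θ⁻¹ • (s.2.1 - s.1))) s.2.2 ≤ ‖K‖ * (θ⁻¹ * 2 * ‖s‖) * ‖s‖ := by
    refine (real_inner_le_norm _ _).trans ?_
    gcongr
    exact (K.le_opNorm _).trans (by gcongr)
  calc energy K ωg ωf τ σ θ s
      ≤ (τ⁻¹ + 2 * ωg) * ‖s‖ ^ 2 + (σ⁻¹ + 2 * ωf) * ‖s‖ ^ 2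
        + τ⁻¹ * (θ⁻¹ * 2 * ‖s‖) ^ 2 + 2 * (‖K‖ * (θ⁻¹ * 2 * ‖s‖) * ‖s‖) := by
        unfold energy
        gcongr
    _ = _ := by ring

end Energy

/-! ### One step of the algorithm: energy contraction and regularity. -/

section Step

variable {d m : ℕ} {K : EuclideanSpace ℝ (Fin d) →L[ℝ] EuclideanSpace ℝ (Fin m)}
  {f : EuclideanSpace ℝ (Fin m) → EReal} {g : EuclideanSpace ℝ (Fin d) → EReal}
  {ωg ωf τ σ θ : ℝ}

theorem energy_step_sub_le (hf : IsPotential (conj f)) (hg : IsPotential g)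
    (hgs : StronglyConvex ωg g) (hfs : StronglyConvex ωf (conj f))
    (hτ : 0 < τ) (hσ : 0 < σ) (hθ0 : 0 < θ)
    (hθg : τ⁻¹ ≤ θ * (τ⁻¹ + 2 * ωg)) (hθf : σ⁻¹ ≤ θ * (σ⁻¹ + 2 * ωf))
    (hstep : θ * σ * τ * ‖K‖ ^ 2 ≤ 1)
    (s s' : EuclideanSpace ℝ (Fin d) × EuclideanSpace ℝ (Fin d) × EuclideanSpace ℝ (Fin m))
    (e : EuclideanSpace ℝ (Fin d)) :
    energy K ωg ωf τ σ θ (step K f g τ σ θ s e - step K f g τ σ θ s' e)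
      ≤ θ * energy K ωg ωf τ σ θ (s - s') := by
  set y := prox σ (conj f) (s.2.2 + σ • K s.2.1) with hy
  set y' := prox σ (conj f) (s'.2.2 + σ • K s'.2.1) with hy'
  set x := prox τ g (s.1 - τ • ContinuousLinearMap.adjoint K y) with hx
  set x' := prox τ g (s'.1 - τ • ContinuousLinearMap.adjoint K y') with hx'
  have hdiff : step K f g τ σ θ s e - step K f g τ σ θ s' e
      = (x - x', (x - x') + θ • ((x - x') - (s.1 - s'.1)), y - y') := by
    ext1
    · simp [step, ← hy, ← hy', ← hx, ← hx']
    ext1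
    · simp only [step, ← hy, ← hy', ← hx, ← hx', Prod.snd_sub, Prod.fst_sub]
      module
    · simp [step, ← hy, ← hy']
  rw [hdiff, energy, energy]
  simp only [add_sub_cancel_left, inv_smul_smul₀ hθ0.ne']
  refine energy_recursion hτ hσ hθ0 hθg hθf hstep ?_ ?_
  · have h := hg.mul_sq_prox_sub_le hgs hτ (s.1 - τ • ContinuousLinearMap.adjoint K y)
      (s'.1 - τ • ContinuousLinearMap.adjoint K y')
    convert h using 2
    simp only [map_sub]
    module
  · have h := hf.mul_sq_prox_sub_le hfs hσ (s.2.2 + σ • K s.2.1) (s'.2.2 + σ • K s'.2.1)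
    convert h using 2
    rw [smul_inv_smul₀ hθ0.ne', ← Prod.fst_sub s s', add_sub_cancel]
    simp only [Prod.snd_sub, Prod.fst_sub, map_sub]
    module

/-- Nonexpansive proximal maps are composed with linear maps. This gives measurability of the step
and preserves square integrability. -/
theorem exists_lipschitzWith_step (hf : IsPotential (conj f)) (hg : IsPotential g)
    (hτ : 0 < τ) (hσ : 0 < σ) :
    ∃ C, LipschitzWith C fun p : (EuclideanSpace ℝ (Fin d) × EuclideanSpace ℝ (Fin d) ×
      EuclideanSpace ℝ (Fin m)) × EuclideanSpace ℝ (Fin d) => step K f g τ σ θ p.1 p.2 := by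
  have hy := (hf.lipschitzWith_prox hσ).comp (((ContinuousLinearMap.snd ℝ _ _).comp
    ((ContinuousLinearMap.snd ℝ _ _).comp (ContinuousLinearMap.fst ℝ (EuclideanSpace ℝ (Fin d) ×
      EuclideanSpace ℝ (Fin d) × EuclideanSpace ℝ (Fin m)) (EuclideanSpace ℝ (Fin d))))
    + σ • K.comp ((ContinuousLinearMap.fst ℝ _ _).comp ((ContinuousLinearMap.snd ℝ _ _).comp
      (ContinuousLinearMap.fst ℝ (EuclideanSpace ℝ (Fin d) × EuclideanSpace ℝ (Fin d) ×
        EuclideanSpace ℝ (Fin m)) (EuclideanSpace ℝ (Fin d)))))).lipschitz)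
  have hx₀ := LipschitzWith.prod_fst.comp (LipschitzWith.prod_fst (α := EuclideanSpace ℝ (Fin d) ×
      EuclideanSpace ℝ (Fin d) × EuclideanSpace ℝ (Fin m)) (β := EuclideanSpace ℝ (Fin d)))
  have hx := ((hg.lipschitzWith_prox hτ).comp (hx₀.sub
    ((τ • ContinuousLinearMap.adjoint K).lipschitz.comp hy))).add
    ((√(2 * τ) • ContinuousLinearMap.snd ℝ (EuclideanSpace ℝ (Fin d) ×
      EuclideanSpace ℝ (Fin d) × EuclideanSpace ℝ (Fin m)) (EuclideanSpace ℝ (Fin d))).lipschitz)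
  have hxθ := hx.add ((θ • ContinuousLinearMap.id ℝ (EuclideanSpace ℝ (Fin d))).lipschitz.comp
    (hx.sub hx₀))
  exact ⟨_, hx.prodMk (hxθ.prodMk hy)⟩

end Step

/-! ### Couplings and random iterations -/

section Markov

variable {S S' G : Type*} [MeasurableSpace S] [MeasurableSpace S'] [MeasurableSpace G]

theorem IsCoupling.isProbabilityMeasure {M : Measure (S × S)} {ρ ρ' : Measure S}
    [IsProbabilityMeasure ρ] (h : IsCoupling M ρ ρ') : IsProbabilityMeasure M := by
  have : IsProbabilityMeasure (M.map Prod.fst) := by rw [h.1]; infer_instance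
  exact ⟨by rw [← measure_univ (μ := M.map Prod.fst),
    Measure.map_apply measurable_fst MeasurableSet.univ, Set.preimage_univ]⟩

theorem IsCoupling.map {M : Measure (S × S)} {ρ ρ' : Measure S} (h : IsCoupling M ρ ρ')
    {q : S → S'} (hq : Measurable q) :
    IsCoupling (M.map (Prod.map q q)) (ρ.map q) (ρ'.map q) := by
  rw [← h.1, ← h.2]
  constructor <;>
    rw [Measure.map_map (by fun_prop) (by fun_prop), Measure.map_map (by fun_prop) (by fun_prop)]
    <;> rfl

theorem isCoupling_prod (ρ ρ' : Measure S) [IsProbabilityMeasure ρ] [IsProbabilityMeasure ρ'] :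
    IsCoupling (ρ.prod ρ') ρ ρ' :=
  ⟨by simp, by simp⟩

theorem transportDist_map_le [Sub S'] {M : Measure (S × S)} {ρ ρ' : Measure S}
    (h : IsCoupling M ρ ρ') {q : S → S'} (hq : Measurable q) (N : S' → ℝ) {D : ℝ≥0∞}
    (hD : ∫⁻ p, ENNReal.ofReal (N (q p.1 - q p.2) ^ 2) ∂M ≤ D) :
    transportDist N (ρ.map q) (ρ'.map q) ≤ D ^ (1 / 2 : ℝ) := by
  refine iInf₂_le_of_le _ (h.map hq) ?_
  gcongr
  exact (lintegral_map_le _ _).trans hD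

/-- The law after one step `s ↦ Φ s e` with fresh noise `e ∼ γ`. -/
noncomputable def evolve (Φ : S → G → S) (γ : Measure G) (ρ : Measure S) : Measure S :=
  (ρ.prod γ).map fun p => Φ p.1 p.2

variable {Φ : S → G → S} {γ : Measure G} [IsProbabilityMeasure γ]

theorem isProbabilityMeasure_evolve (hΦ : Measurable fun p : S × G => Φ p.1 p.2) (ρ : Measure S)
    [IsProbabilityMeasure ρ] : IsProbabilityMeasure (evolve Φ γ ρ) :=
  Measure.isProbabilityMeasure_map hΦ.aemeasurable

/-- The synchronous coupling: both components receive the same noise `e`, so the pointwise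
contraction of the cost can be integrated. -/
theorem IsCoupling.exists_evolve (hΦ : Measurable fun p : S × G => Φ p.1 p.2)
    {c : S × S → ℝ≥0∞} (hc : Measurable c) {k : ℝ≥0∞}
    (hk : ∀ s s' e, c (Φ s e, Φ s' e) ≤ k * c (s, s')) {ρ ρ' : Measure S}
    [IsProbabilityMeasure ρ] {M : Measure (S × S)} (hM : IsCoupling M ρ ρ') :
    ∃ M', IsCoupling M' (evolve Φ γ ρ) (evolve Φ γ ρ') ∧ ∫⁻ p, c p ∂M' ≤ k * ∫⁻ p, c p ∂M := by
  have := hM.isProbabilityMeasure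
  have h1 : Measurable fun p : (S × S) × G => Φ p.1.1 p.2 :=
    hΦ.comp (by fun_prop : Measurable fun p : (S × S) × G => (p.1.1, p.2))
  have h2 : Measurable fun p : (S × S) × G => Φ p.1.2 p.2 :=
    hΦ.comp (by fun_prop : Measurable fun p : (S × S) × G => (p.1.2, p.2))
  have hid : γ.map id = γ := Measure.map_id
  refine ⟨(M.prod γ).map fun p => (Φ p.1.1 p.2, Φ p.1.2 p.2), ⟨?_, ?_⟩, ?_⟩
  · rw [evolve, ← hM.1]
    conv_rhs => rw [← hid]
    rw [Measure.map_prod_map _ _ measurable_fst measurable_id,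
      Measure.map_map hΦ (by fun_prop), Measure.map_map measurable_fst (h1.prodMk h2)]
    rfl
  · rw [evolve, ← hM.2]
    conv_rhs => rw [← hid]
    rw [Measure.map_prod_map _ _ measurable_snd measurable_id,
      Measure.map_map hΦ (by fun_prop), Measure.map_map measurable_snd (h1.prodMk h2)]
    rfl
  · rw [lintegral_map hc (h1.prodMk h2), ← lintegral_const_mul _ hc,
      ← (measurePreserving_fst (μ := M) (ν := γ)).lintegral_comp (hc.const_mul k)]
    exact lintegral_mono fun p => hk _ _ _

theorem IsCoupling.exists_evolve_iterate (hΦ : Measurable fun p : S × G => Φ p.1 p.2)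
    {c : S × S → ℝ≥0∞} (hc : Measurable c) {k : ℝ≥0∞}
    (hk : ∀ s s' e, c (Φ s e, Φ s' e) ≤ k * c (s, s')) {ρ ρ' : Measure S}
    [IsProbabilityMeasure ρ] {M : Measure (S × S)} (hM : IsCoupling M ρ ρ') (n : ℕ) :
    ∃ M', IsCoupling M' ((evolve Φ γ)^[n] ρ) ((evolve Φ γ)^[n] ρ') ∧
      ∫⁻ p, c p ∂M' ≤ k ^ n * ∫⁻ p, c p ∂M := by
  induction n generalizing ρ ρ' M with
  | zero => exact ⟨M, hM, by simp⟩
  | succ n ih =>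
    obtain ⟨M₁, hM₁, hle₁⟩ := hM.exists_evolve (γ := γ) hΦ hc hk
    have := isProbabilityMeasure_evolve (γ := γ) hΦ ρ
    obtain ⟨M₂, hM₂, hle₂⟩ := ih hM₁
    refine ⟨M₂, hM₂, hle₂.trans ?_⟩
    rw [pow_succ, mul_assoc]
    gcongr

/-- Splitting off the first coordinate of an i.i.d. sequence. -/
theorem measurePreserving_head_tail (γ : Measure G) [IsProbabilityMeasure γ] :
    MeasurePreserving (fun ω : ℕ → G => (ω 0, fun n => ω (n + 1)))
      (Measure.infinitePi fun _ => γ) (γ.prod (Measure.infinitePi fun _ => γ)) where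
  measurable := by fun_prop
  map_eq := by
    have hind : iIndepFun (fun (n : ℕ) (ω : ℕ → G) => ω n) (Measure.infinitePi fun _ => γ) :=
      iIndepFun_infinitePi (X := fun _ x => x) fun _ => measurable_id
    have h : IndepFun (fun ω : ℕ → G => ω 0) (fun (ω : ℕ → G) n => ω (n + 1))
        (Measure.infinitePi fun _ => γ) := by
      refine IndepFun.indepFun_process (by fun_prop) (by fun_prop) fun I => ?_
      have hfin := hind.indepFun_finset {0} (I.map ⟨Nat.succ, Nat.succ_injective⟩)
        (by simp) (by fun_prop)
      exact hfin.comp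
        (by fun_prop : Measurable fun h : ({0} : Finset ℕ) → G => h ⟨0, Finset.mem_singleton_self 0⟩)
        (by fun_prop : Measurable fun (h : (I.map ⟨Nat.succ, Nat.succ_injective⟩) → G) (i : I) =>
          h ⟨i + 1, Finset.mem_map_of_mem _ i.2⟩)
    have htail := Measure.map_infinitePi_infinitePi_of_inj (P := fun _ : ℕ => γ)
      (f := fun n : ℕ => n + 1) (add_left_injective 1)
    have hhead := Measure.infinitePi_map_eval (fun _ : ℕ => γ) 0
    rw [h.map_prod_eq_prod_map_map (Measurable.aemeasurable (by fun_prop))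
      (Measurable.aemeasurable (by fun_prop)), htail]
    congr 1

theorem measurable_iteration (hΦ : Measurable fun p : S × G => Φ p.1 p.2) {Ω : Type*}
    [MeasurableSpace Ω] {ξ : ℕ → Ω → G} {Z : ℕ → Ω → S} (hZ₀ : Measurable (Z 0))
    (hξ : ∀ n, Measurable (ξ n)) (hstep : ∀ n ω, Z (n + 1) ω = Φ (Z n ω) (ξ n ω)) (n : ℕ) :
    Measurable (Z n) := by
  induction n with
  | zero => exact hZ₀
  | succ n ih =>
    rw [funext (hstep n)]
    exact hΦ.comp (ih.prodMk (hξ n))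

/-- The law of a random iteration started independently of its i.i.d. noise. -/
theorem map_eq_evolve_iterate (hΦ : Measurable fun p : S × G => Φ p.1 p.2) {Ω : Type*}
    [MeasurableSpace Ω] {P : Measure Ω} [IsProbabilityMeasure P] {ξ : ℕ → Ω → G} {Z : ℕ → Ω → S}
    (hZ₀ : Measurable (Z 0)) (hξ : ∀ n, Measurable (ξ n)) (hlaw : ∀ n, P.map (ξ n) = γ)
    (hind : iIndepFun ξ P) (hind₀ : IndepFun (Z 0) (fun ω n => ξ n ω) P)
    (hstep : ∀ n ω, Z (n + 1) ω = Φ (Z n ω) (ξ n ω)) (n : ℕ) :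
    P.map (Z n) = (evolve Φ γ)^[n] (P.map (Z 0)) := by
  have hZ := measurable_iteration hΦ hZ₀ hξ hstep
  have hZp : ∀ n, IsProbabilityMeasure (P.map (Z n)) :=
    fun n => Measure.isProbabilityMeasure_map (hZ n).aemeasurable
  -- The invariant of the induction: the present state is independent of all future noise, which
  -- remains i.i.d. with law `γ`.
  have hjoint : ∀ n, P.map (fun ω => (Z n ω, fun k => ξ (n + k) ω)) =
      (P.map (Z n)).prod (Measure.infinitePi fun _ => γ) ∧
      P.map (Z (n + 1)) = evolve Φ γ (P.map (Z n)) := by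
    have hnext : ∀ n, P.map (fun ω => (Z n ω, fun k => ξ (n + k) ω)) =
        (P.map (Z n)).prod (Measure.infinitePi fun _ => γ) →
        P.map (fun ω => ((Z n ω, ξ n ω), fun k => ξ (n + 1 + k) ω)) =
        ((P.map (Z n)).prod γ).prod (Measure.infinitePi fun _ => γ) := by
      intro n hn
      have e : (fun ω => ((Z n ω, ξ n ω), fun k => ξ (n + 1 + k) ω)) =
          MeasurableEquiv.prodAssoc.symm ∘ (Prod.map id fun ω : ℕ → G => (ω 0, fun n => ω (n + 1)))
            ∘ (fun ω => (Z n ω, fun k => ξ (n + k) ω)) := by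
        funext ω
        simp only [Function.comp, Prod.map, MeasurableEquiv.prodAssoc, MeasurableEquiv.symm_mk, id]
        simp [Nat.add_right_comm, Nat.add_assoc]
      rw [e, ← Measure.map_map (by fun_prop) (by fun_prop),
        ← Measure.map_map (by fun_prop) (by fun_prop), hn,
        ← Measure.map_prod_map _ _ measurable_id (by fun_prop), Measure.map_id,
        (measurePreserving_head_tail γ).map_eq]
      exact (measurePreserving_prodAssoc _ _ _).symm.map_eq
    have hevolve : ∀ n, P.map (fun ω => (Z n ω, fun k => ξ (n + k) ω)) =
        (P.map (Z n)).prod (Measure.infinitePi fun _ => γ) →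
        P.map (Z (n + 1)) = evolve Φ γ (P.map (Z n)) := by
      intro n hn
      have h := congrArg (Measure.map Prod.fst) (hnext n hn)
      rw [Measure.map_fst_prod, measure_univ, one_smul, Measure.map_map (by fun_prop)
        (by fun_prop)] at h
      rw [evolve, ← h, Measure.map_map hΦ (by fun_prop), funext (hstep n)]
      rfl
    intro n
    suffices h : P.map (fun ω => (Z n ω, fun k => ξ (n + k) ω)) =
      (P.map (Z n)).prod (Measure.infinitePi fun _ => γ) from ⟨h, hevolve n h⟩
    induction n with
    | zero =>
      simp only [zero_add]
      rw [hind₀.map_prod_eq_prod_map_map hZ₀.aemeasurable (by fun_prop),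
        hind.map_fun_eq_infinitePi_map hξ]
      simp only [hlaw]
    | succ n ih =>
      have h := congrArg (Measure.map (Prod.map (fun p : S × G => Φ p.1 p.2) id)) (hnext n ih)
      rw [← Measure.map_prod_map _ _ hΦ measurable_id, Measure.map_id,
        Measure.map_map (by fun_prop) (by fun_prop)] at h
      rw [hevolve n ih, evolve, ← h, funext (hstep n)]
      rfl
  induction n with
  | zero => rfl
  | succ n ih => rw [(hjoint n).2, ih, Function.iterate_succ_apply']

end Markov

theorem memLp_prodMk {Ω E F : Type*} [MeasurableSpace Ω] [NormedAddCommGroup E]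
    [NormedAddCommGroup F] {μ : Measure Ω} {p : ℝ≥0∞} {u : Ω → E} {v : Ω → F}
    (hu : MemLp u p μ) (hv : MemLp v p μ) : MemLp (fun ω => (u ω, v ω)) p μ := by
  refine (hu.norm.add hv.norm).mono (hu.1.prodMk hv.1) (ae_of_all _ fun ω => ?_)
  rw [Prod.norm_def, Pi.add_apply, Real.norm_of_nonneg (by positivity)]
  exact max_le_add_of_nonneg (norm_nonneg _) (norm_nonneg _)

/-! ### Existence of a stationary law. -/

section Stationary

variable {S G : Type*} [NormedAddCommGroup S] [CompleteSpace S] [MeasurableSpace S] [BorelSpace S]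
  [SecondCountableTopology S] [NormedAddCommGroup G] [MeasurableSpace G] [BorelSpace G]
  [SecondCountableTopology G] {Φ : S → G → S} {γ : Measure G} [IsProbabilityMeasure γ]

/-- A random iteration that contracts an energy equivalent to the square of the norm has a
stationary distribution with finite second moment. -/
theorem exists_stationary {L : NNReal} (hΦ : LipschitzWith L fun p : S × G => Φ p.1 p.2)
    (hγ : MemLp id 2 γ) {U : S → ℝ} (hU : Continuous U) {c C θ : ℝ} (hc : 0 < c) (hC : 0 < C)
    (hθ0 : 0 ≤ θ) (hθ1 : θ < 1) (hcU : ∀ s, c * ‖s‖ ^ 2 ≤ U s) (hUC : ∀ s, U s ≤ C * ‖s‖ ^ 2)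
    (hcontr : ∀ s s' e, U (Φ s e - Φ s' e) ≤ θ * U (s - s')) :
    ∃ ρ : Measure S, IsProbabilityMeasure ρ ∧ evolve Φ γ ρ = ρ ∧ MemLp id 2 ρ := by
  set P : Measure (ℕ → G) := Measure.infinitePi fun _ => γ with hP
  have hht := measurePreserving_head_tail γ
  have hhead : MeasurePreserving (fun ω : ℕ → G => ω 0) P γ := measurePreserving_fst.comp hht
  have htail : MeasurePreserving (fun (ω : ℕ → G) n => ω (n + 1)) P P :=
    measurePreserving_snd.comp hht
  have hmem : ∀ Z : Lp S 2 P, MemLp (fun ω => Φ (Z fun n => ω (n + 1)) (ω 0)) 2 P := by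
    intro Z
    have h1 : MemLp (fun ω : ℕ → G => (Z fun n => ω (n + 1), ω 0)) 2 P :=
      memLp_prodMk ((Lp.memLp Z).comp_measurePreserving htail) (hγ.comp_measurePreserving hhead)
    have h2 := (hΦ.sub (LipschitzWith.const (Φ 0 0))).comp_memLp (by simp) h1
    refine (h2.add (memLp_const (Φ 0 0))).congr_norm (hΦ.continuous.comp_aestronglyMeasurable
      h1.aestronglyMeasurable) (ae_of_all _ fun ω => ?_)
    simp
  -- The state is a function of the noise sequence: `T` evaluates it on the shifted sequence and
  -- then makes one step with the head. Working in `L²` supplies the complete space for Banach's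
  -- theorem.
  set T : Lp S 2 P → Lp S 2 P := fun Z => (hmem Z).toLp _ with hT
  have hTae : ∀ Z, T Z =ᵐ[P] fun ω => Φ (Z fun n => ω (n + 1)) (ω 0) :=
    fun Z => (hmem Z).coeFn_toLp
  have hsq : ∀ Z Z' : Lp S 2 P, edist Z Z' ^ 2 = ∫⁻ ω, ‖Z ω - Z' ω‖ₑ ^ 2 ∂P := by
    intro Z Z'
    have h := eLpNorm_nnreal_pow_eq_lintegral (μ := P) (f := ⇑Z - ⇑Z') (p := 2) two_ne_zero
    rw [Lp.edist_def]
    simpa using h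
  have hofReal : ∀ (a : ℝ) (s : S), 0 ≤ a →
      ENNReal.ofReal (a * ‖s‖ ^ 2) = ENNReal.ofReal a * ‖s‖ₑ ^ 2 := fun a s ha => by
    rw [ENNReal.ofReal_mul ha, ENNReal.ofReal_pow (norm_nonneg _), ofReal_norm]
  set D : Lp S 2 P → Lp S 2 P → ℝ≥0∞ := fun Z Z' => ∫⁻ ω, ENNReal.ofReal (U (Z ω - Z' ω)) ∂P
    with hD
  have hcD : ∀ Z Z', ENNReal.ofReal c * edist Z Z' ^ 2 ≤ D Z Z' := by
    intro Z Z'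
    rw [hsq, ← lintegral_const_mul' _ _ ENNReal.ofReal_ne_top]
    refine lintegral_mono fun ω => ?_
    rw [← hofReal _ _ hc.le]
    exact ENNReal.ofReal_le_ofReal (hcU _)
  have hDC : ∀ Z Z', D Z Z' ≤ ENNReal.ofReal C * edist Z Z' ^ 2 := by
    intro Z Z'
    rw [hsq, ← lintegral_const_mul' _ _ ENNReal.ofReal_ne_top]
    refine lintegral_mono fun ω => ?_
    rw [← hofReal _ _ hC.le]
    exact ENNReal.ofReal_le_ofReal (hUC _)
  have hDT : ∀ Z Z', D (T Z) (T Z') ≤ ENNReal.ofReal θ * D Z Z' := by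
    intro Z Z'
    have hmeas : Measurable fun ω => ENNReal.ofReal (U (Z ω - Z' ω)) :=
      (hU.measurable.comp ((Lp.stronglyMeasurable Z).measurable.sub
        (Lp.stronglyMeasurable Z').measurable)).ennreal_ofReal
    calc D (T Z) (T Z') ≤ ∫⁻ ω, ENNReal.ofReal θ * ENNReal.ofReal
            (U (Z (fun n => ω (n + 1)) - Z' fun n => ω (n + 1))) ∂P := by
          refine lintegral_mono_ae ?_
          filter_upwards [hTae Z, hTae Z'] with ω h h'
          rw [h, h', ← ENNReal.ofReal_mul hθ0]
          exact ENNReal.ofReal_le_ofReal (hcontr _ _ _)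
      _ = ENNReal.ofReal θ * D Z Z' := by
          rw [lintegral_const_mul' _ _ ENNReal.ofReal_ne_top, hD]
          congr 1
          exact htail.lintegral_comp hmeas
  have hDTn : ∀ n Z Z', D (T^[n] Z) (T^[n] Z') ≤ ENNReal.ofReal θ ^ n * D Z Z' := by
    intro n
    induction n with
    | zero => simp
    | succ n ih =>
      intro Z Z'
      rw [Function.iterate_succ_apply, Function.iterate_succ_apply, pow_succ, mul_assoc]
      exact (ih _ _).trans (by gcongr; exact hDT _ _)
  -- The equivalence of energy and norm costs a factor `C / c`; enough iterations bring `θ ^ n * C /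
  -- c` below `1 / 4`, the square of the contraction constant `1 / 2`.
  obtain ⟨n, hn⟩ : ∃ n, θ ^ n < c / (4 * C) := exists_pow_lt_of_lt_one (by positivity) hθ1
  have hcontrn : ContractingWith (1 / 2) T^[n] := by
    refine ⟨by rw [← NNReal.coe_lt_coe]; norm_num, fun Z Z' => ?_⟩
    have h1 : ENNReal.ofReal c * edist (T^[n] Z) (T^[n] Z') ^ 2
        ≤ ENNReal.ofReal c * (ENNReal.ofReal (1 / 2) * edist Z Z') ^ 2 := by
      refine (hcD _ _).trans ((hDTn n Z Z').trans ?_)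
      calc ENNReal.ofReal θ ^ n * D Z Z'
          ≤ ENNReal.ofReal θ ^ n * (ENNReal.ofReal C * edist Z Z' ^ 2) := by gcongr; exact hDC _ _
        _ = ENNReal.ofReal (θ ^ n * C) * edist Z Z' ^ 2 := by
            rw [← mul_assoc, ENNReal.ofReal_mul (by positivity), ENNReal.ofReal_pow hθ0]
        _ ≤ ENNReal.ofReal (c * (1 / 2) ^ 2) * edist Z Z' ^ 2 := by
            rw [lt_div_iff₀ (by positivity)] at hn
            exact mul_le_mul_left (ENNReal.ofReal_le_ofReal (by linarith)) _
        _ = _ := by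
            rw [ENNReal.ofReal_mul hc.le, ENNReal.ofReal_pow (by norm_num), mul_pow, mul_assoc]
    rw [ENNReal.mul_le_mul_iff_right (by simpa using hc) ENNReal.ofReal_ne_top] at h1
    have h2 := (ENNReal.pow_le_pow_left_iff two_ne_zero).1 h1
    simpa using h2
  obtain ⟨Z, hZ⟩ : ∃ Z, T Z = Z := ⟨_, hcontrn.isFixedPt_fixedPoint_iterate⟩
  have hZm : Measurable Z := (Lp.stronglyMeasurable Z).measurable
  refine ⟨P.map Z, Measure.isProbabilityMeasure_map hZm.aemeasurable, ?_, ?_⟩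
  -- `Z` of the tail is independent of the head and has the law of `Z`, so the fixed point equation
  -- becomes invariance of that law.
  · have h1 : (P.map Z).prod γ = P.map (fun ω => (Z fun n => ω (n + 1), ω 0)) := by
      have h2 : P.map (fun ω => (ω 0, fun n => ω (n + 1))) = γ.prod P := hht.map_eq
      have h3 : (fun ω : ℕ → G => (Z fun n => ω (n + 1), ω 0)) =
        (Prod.map Z id ∘ Prod.swap) ∘ fun ω : ℕ → G => (ω 0, fun n => ω (n + 1)) := rfl
      rw [h3, ← Measure.map_map (by fun_prop) (by fun_prop), h2,
        ← Measure.map_map (by fun_prop) (by fun_prop), Measure.prod_swap,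
        ← Measure.map_prod_map _ _ hZm measurable_id, Measure.map_id]
    rw [evolve, h1, Measure.map_map hΦ.continuous.measurable (by fun_prop)]
    refine Measure.map_congr ?_
    have h := hTae Z
    rw [hZ] at h
    exact h.symm
  · rw [memLp_map_measure_iff aestronglyMeasurable_id hZm.aemeasurable]
    exact Lp.memLp Z

end Stationary

/-! ### From energy contraction to transport distances. -/

section Contraction

variable {S E : Type*} [AddGroup S] [MeasurableSpace S] [MeasurableSub₂ S] {G : Type*}
  [MeasurableSpace G] [AddGroup E] [MeasurableSpace E] {Φ : S → G → S} {γ : Measure G}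
  [IsProbabilityMeasure γ]

/-- Keeping the initial coupling `M` arbitrary serves two purposes: an infimum over `M` compares two
chains, and a product coupling gives convergence to the stationary law. The map `q` selects the
marginal of interest. -/
theorem transportDist_evolve_le (hΦ : Measurable fun p : S × G => Φ p.1 p.2) {U : S → ℝ}
    (hU : Measurable U) {θ : ℝ} (hθ : 0 ≤ θ)
    (hcontr : ∀ s s' e, U (Φ s e - Φ s' e) ≤ θ * U (s - s')) {ρ ρ' : Measure S}
    [IsProbabilityMeasure ρ] {M : Measure (S × S)} (hM : IsCoupling M ρ ρ') {q : S →+ E}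
    (hq : Measurable q) {N : E → ℝ} {κ : ℝ} (hκ : 0 < κ) (hN : ∀ s, κ * N (q s) ^ 2 ≤ U s)
    (n : ℕ) :
    transportDist N (((evolve Φ γ)^[n] ρ).map q) (((evolve Φ γ)^[n] ρ').map q) ≤
      (ENNReal.ofReal (κ⁻¹ * θ ^ n) * ∫⁻ p, ENNReal.ofReal (U (p.1 - p.2)) ∂M) ^ (1 / 2 : ℝ) := by
  obtain ⟨M', hM', hle⟩ := hM.exists_evolve_iterate (γ := γ) hΦ
    (c := fun p => ENNReal.ofReal (U (p.1 - p.2)))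
    (hU.comp (measurable_fst.sub measurable_snd)).ennreal_ofReal (k := ENNReal.ofReal θ)
    (fun s s' e => by
      rw [← ENNReal.ofReal_mul hθ]
      exact ENNReal.ofReal_le_ofReal (hcontr s s' e)) n
  refine transportDist_map_le hM' hq N ?_
  calc ∫⁻ p, ENNReal.ofReal (N (q p.1 - q p.2) ^ 2) ∂M'
      ≤ ∫⁻ p, ENNReal.ofReal κ⁻¹ * ENNReal.ofReal (U (p.1 - p.2)) ∂M' := by
        refine lintegral_mono fun p => ?_
        rw [← ENNReal.ofReal_mul (by positivity), ← map_sub]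
        refine ENNReal.ofReal_le_ofReal ?_
        rw [inv_mul_eq_div, le_div_iff₀' hκ]
        exact hN _
    _ = ENNReal.ofReal κ⁻¹ * ∫⁻ p, ENNReal.ofReal (U (p.1 - p.2)) ∂M' :=
        lintegral_const_mul' _ _ ENNReal.ofReal_ne_top
    _ ≤ _ := by
        rw [ENNReal.ofReal_mul (by positivity), ENNReal.ofReal_pow hθ, mul_assoc]
        gcongr

end Contraction

theorem lintegral_ofReal_comp_lt_top {Ω E : Type*} [MeasurableSpace Ω] {μ : Measure Ω}
    [NormedAddCommGroup E] {U : E → ℝ} {C : ℝ} (hC : 0 ≤ C) (hUC : ∀ s, U s ≤ C * ‖s‖ ^ 2)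
    {v : Ω → E} (hv : MemLp v 2 μ) : ∫⁻ ω, ENNReal.ofReal (U (v ω)) ∂μ < ∞ := by
  have h := eLpNorm_nnreal_pow_eq_lintegral (μ := μ) (f := v) (p := 2) two_ne_zero
  have h2 : eLpNorm v 2 μ ^ 2 = ∫⁻ ω, ‖v ω‖ₑ ^ 2 ∂μ := by simpa using h
  calc ∫⁻ ω, ENNReal.ofReal (U (v ω)) ∂μ ≤ ∫⁻ ω, ENNReal.ofReal C * ‖v ω‖ₑ ^ 2 ∂μ := by
        refine lintegral_mono fun ω => ?_
        rw [← ofReal_norm, ← ENNReal.ofReal_pow (norm_nonneg _), ← ENNReal.ofReal_mul hC]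
        exact ENNReal.ofReal_le_ofReal (hUC _)
    _ = ENNReal.ofReal C * eLpNorm v 2 μ ^ 2 := by
        rw [lintegral_const_mul' _ _ ENNReal.ofReal_ne_top, h2]
    _ < ∞ := ENNReal.mul_lt_top ENNReal.ofReal_lt_top (ENNReal.pow_lt_top hv.2)

theorem ofReal_mul_rpow_half {r : ℝ} (hr : 0 ≤ r) (I : ℝ≥0∞) :
    (ENNReal.ofReal r * I) ^ (1 / 2 : ℝ) = ENNReal.ofReal (r ^ (1 / 2 : ℝ)) * I ^ (1 / 2 : ℝ) := by
  rw [ENNReal.mul_rpow_of_nonneg _ _ (by norm_num),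
    ENNReal.ofReal_rpow_of_nonneg hr (by norm_num)]

theorem sq_weightedNorm {E F : Type*} [NormedAddCommGroup E] [NormedAddCommGroup F] {a b : ℝ}
    (ha : 0 ≤ a) (hb : 0 ≤ b) (z : E × F) :
    weightedNorm a b z ^ 2 = a * ‖z.1‖ ^ 2 + b * ‖z.2‖ ^ 2 :=
  Real.sq_sqrt (by positivity)

/-! ### Laws of the chain. -/

section Chain

variable {d m : ℕ} {K : EuclideanSpace ℝ (Fin d) →L[ℝ] EuclideanSpace ℝ (Fin m)}
  {f : EuclideanSpace ℝ (Fin m) → EReal} {g : EuclideanSpace ℝ (Fin d) → EReal}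
  {ωg ωf τ σ θ : ℝ}

theorem measurable_step (hf : IsPotential (conj f)) (hg : IsPotential g) (hτ : 0 < τ)
    (hσ : 0 < σ) : Measurable fun p : (EuclideanSpace ℝ (Fin d) × EuclideanSpace ℝ (Fin d) ×
      EuclideanSpace ℝ (Fin m)) × EuclideanSpace ℝ (Fin d) => step K f g τ σ θ p.1 p.2 := by
  obtain ⟨C, hC⟩ := exists_lipschitzWith_step (K := K) (θ := θ) hf hg hτ hσ
  exact hC.continuous.measurable

/-- The law of the state `(X^n, X_θ^n, Y^n)` in terms of the initial law. -/
theorem IsChain.map_state (hf : IsPotential (conj f)) (hg : IsPotential g) (hτ : 0 < τ)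
    (hσ : 0 < σ) {Ω : Type*} [MeasurableSpace Ω] {P : Measure Ω} [IsProbabilityMeasure P]
    {ξ X Xθ : ℕ → Ω → EuclideanSpace ℝ (Fin d)} {Y : ℕ → Ω → EuclideanSpace ℝ (Fin m)}
    (h : IsChain K f g τ σ θ P ξ X Xθ Y) (n : ℕ) :
    Measurable (fun ω => (X n ω, Xθ n ω, Y n ω)) ∧
    P.map (fun ω => (X n ω, Xθ n ω, Y n ω)) =
      (evolve (step K f g τ σ θ) (stdGaussian (EuclideanSpace ℝ (Fin d))))^[n]
        ((P.map fun ω => (X 0 ω, Y 0 ω)).map fun z => (z.1, z.1, z.2)) := by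
  have hstep : ∀ n ω, (X (n + 1) ω, Xθ (n + 1) ω, Y (n + 1) ω) =
      step K f g τ σ θ (X n ω, Xθ n ω, Y n ω) (ξ n ω) := by
    intro n ω
    rw [h.extrapolation_step, h.primal_step, h.dual_step]
    rfl
  have h0 : (fun ω => (X 0 ω, Xθ 0 ω, Y 0 ω)) = fun ω => (X 0 ω, X 0 ω, Y 0 ω) := by
    funext ω
    rw [h.extrapolation_zero]
  have hX := h.measurable_X_zero
  have hY := h.measurable_Y_zero
  have hm0 : Measurable (fun ω => (X 0 ω, Xθ 0 ω, Y 0 ω)) := by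
    rw [h0]
    fun_prop
  have hΦ := measurable_step (K := K) (θ := θ) hf hg hτ hσ
  constructor
  · exact measurable_iteration (Z := fun n ω => (X n ω, Xθ n ω, Y n ω)) hΦ hm0
      h.measurable_noise hstep n
  · have hdiag : Measurable fun z : EuclideanSpace ℝ (Fin d) × EuclideanSpace ℝ (Fin m) =>
      (z.1, z.1, z.2) := by fun_prop
    have hind : IndepFun (fun ω => (X 0 ω, Xθ 0 ω, Y 0 ω)) (fun ω n => ξ n ω) P := by
      rw [h0]
      exact h.indep_initial.comp hdiag measurable_id
    have hinit : (P.map fun ω => (X 0 ω, Y 0 ω)).map (fun z => (z.1, z.1, z.2)) =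
        P.map fun ω => (X 0 ω, Xθ 0 ω, Y 0 ω) := by
      rw [Measure.map_map hdiag (hX.prodMk hY), h0]
      rfl
    rw [hinit]
    exact map_eq_evolve_iterate (Z := fun n ω => (X n ω, Xθ n ω, Y n ω)) hΦ hm0
      h.measurable_noise h.law_noise h.iIndep_noise hind hstep n

/-- Contraction of a transport distance between the laws of `q (X^n, X_θ^n, Y^n)` for two
chains, if the energy dominates the distance. -/
theorem transportDist_chain_le (hf : IsPotential (conj f)) (hg : IsPotential g)
    (hωg : 0 < ωg) (hωf : 0 < ωf) (hτ : 0 < τ) (hσ : 0 < σ) (hθ0 : 0 < θ)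
    (hcontr : ∀ s s' e, energy K ωg ωf τ σ θ (step K f g τ σ θ s e - step K f g τ σ θ s' e) ≤
      θ * energy K ωg ωf τ σ θ (s - s'))
    {Ω : Type*} [MeasurableSpace Ω] {P : Measure Ω} [IsProbabilityMeasure P]
    {ξ X Xθ X' Xθ' : ℕ → Ω → EuclideanSpace ℝ (Fin d)}
    {Y Y' : ℕ → Ω → EuclideanSpace ℝ (Fin m)}
    (h : IsChain K f g τ σ θ P ξ X Xθ Y) (h' : IsChain K f g τ σ θ P ξ X' Xθ' Y')
    {H : Type*} [AddGroup H] [MeasurableSpace H]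
    {q : EuclideanSpace ℝ (Fin d) × EuclideanSpace ℝ (Fin d) × EuclideanSpace ℝ (Fin m) →+ H}
    (hq : Measurable q) {W : H → ℝ} {κ : ℝ} (hκ : 0 < κ)
    (hW : ∀ s, κ * (τ⁻¹ + 2 * ωg) * W (q s) ^ 2 ≤ energy K ωg ωf τ σ θ s) (n : ℕ) :
    transportDist W (P.map fun ω => q (X n ω, Xθ n ω, Y n ω))
        (P.map fun ω => q (X' n ω, Xθ' n ω, Y' n ω)) ≤
      ENNReal.ofReal (κ ^ (-(1 / 2) : ℝ) * θ ^ ((n : ℝ) / 2)) *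
        T 1 ((σ⁻¹ + 2 * ωf) / (τ⁻¹ + 2 * ωg)) (P.map fun ω => (X 0 ω, Y 0 ω))
          (P.map fun ω => (X' 0 ω, Y' 0 ω)) := by
  obtain ⟨hm, hlaw⟩ := h.map_state hf hg hτ hσ n
  obtain ⟨hm', hlaw'⟩ := h'.map_state hf hg hτ hσ n
  have e1 := Measure.map_map (μ := P) hq hm
  have e2 := Measure.map_map (μ := P) hq hm'
  simp only [Function.comp_def] at e1 e2
  rw [← e1, ← e2, hlaw, hlaw', T, transportDist.eq_1 (weightedNorm _ _)]
  have ha : 0 < τ⁻¹ + 2 * ωg := by positivity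
  have hb : 0 < σ⁻¹ + 2 * ωf := by positivity
  -- A nonzero finite constant may be moved inside the infimum over initial couplings, so no optimal
  -- coupling is needed and infinite distances are covered.
  have hC0 : ENNReal.ofReal (κ ^ (-(1 / 2) : ℝ) * θ ^ ((n : ℝ) / 2)) ≠ 0 := by
    rw [ENNReal.ofReal_ne_zero_iff]
    positivity
  rw [ENNReal.mul_iInf_of_ne hC0 ENNReal.ofReal_ne_top]
  refine le_iInf fun M => ?_
  rw [ENNReal.mul_iInf_of_ne hC0 ENNReal.ofReal_ne_top]
  refine le_iInf fun hM => ?_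
  have hX := h.measurable_X_zero
  have hY := h.measurable_Y_zero
  have hdiag : Measurable fun z : EuclideanSpace ℝ (Fin d) × EuclideanSpace ℝ (Fin m) =>
    (z.1, z.1, z.2) := by fun_prop
  have : IsProbabilityMeasure (P.map fun ω => (X 0 ω, Y 0 ω)) :=
    Measure.isProbabilityMeasure_map (by fun_prop)
  have : IsProbabilityMeasure ((P.map fun ω => (X 0 ω, Y 0 ω)).map fun z => (z.1, z.1, z.2)) :=
    Measure.isProbabilityMeasure_map hdiag.aemeasurable
  have hU := (continuous_energy (K := K) (ωg := ωg) (ωf := ωf) (τ := τ) (σ := σ)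
    (θ := θ)).measurable
  refine (transportDist_evolve_le (measurable_step hf hg hτ hσ) hU hθ0.le hcontr (hM.map hdiag) hq
    (by positivity) hW n).trans (le_of_eq ?_)
  rw [lintegral_map (by fun_prop) (by fun_prop)]
  -- Since `Xθ 0 = X 0`, differences of initial states have no increment term, and the energy is
  -- exactly `τ⁻¹ + 2ωg` times the weighted cost.
  have hI : ∀ p : (EuclideanSpace ℝ (Fin d) × EuclideanSpace ℝ (Fin m)) ×
      (EuclideanSpace ℝ (Fin d) × EuclideanSpace ℝ (Fin m)),
      ENNReal.ofReal (energy K ωg ωf τ σ θ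
        ((Prod.map (fun z : EuclideanSpace ℝ (Fin d) × EuclideanSpace ℝ (Fin m) =>
          (z.1, z.1, z.2)) (fun z => (z.1, z.1, z.2)) p).1 -
        (Prod.map (fun z : EuclideanSpace ℝ (Fin d) × EuclideanSpace ℝ (Fin m) =>
          (z.1, z.1, z.2)) (fun z => (z.1, z.1, z.2)) p).2)) =
      ENNReal.ofReal (τ⁻¹ + 2 * ωg) * ENNReal.ofReal
        (weightedNorm 1 ((σ⁻¹ + 2 * ωf) / (τ⁻¹ + 2 * ωg)) (p.1 - p.2) ^ 2) := by
    intro p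
    rw [← ENNReal.ofReal_mul ha.le, sq_weightedNorm zero_le_one (by positivity)]
    congr 1
    rw [Prod.map_fst, Prod.map_snd, Prod.mk_sub_mk, Prod.mk_sub_mk, energy_diag]
    field_simp
  simp only [hI]
  rw [lintegral_const_mul' _ _ ENNReal.ofReal_ne_top, ← mul_assoc,
    ← ENNReal.ofReal_mul (by positivity), ofReal_mul_rpow_half (by positivity)]
  congr 2
  have e : (κ * (τ⁻¹ + 2 * ωg))⁻¹ * θ ^ n * (τ⁻¹ + 2 * ωg) = κ⁻¹ * θ ^ (n : ℝ) := by
    rw [Real.rpow_natCast, mul_inv]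
    field_simp
  rw [e, Real.mul_rpow (by positivity) (by positivity), ← Real.rpow_mul hθ0.le,
    Real.inv_rpow hκ.le, ← Real.rpow_neg hκ.le, mul_one_div]

end Chain

end ULPDA

theorem mainTheorem5 {d m : ℕ}
    (K : EuclideanSpace ℝ (Fin d) →L[ℝ] EuclideanSpace ℝ (Fin m))
    (f : EuclideanSpace ℝ (Fin m) → EReal) (g : EuclideanSpace ℝ (Fin d) → EReal)
    (hf : ULPDA.IsPotential f) (hg : ULPDA.IsPotential g)
    (ωg ωf τ σ θ lam lam' : ℝ) (hωg : 0 < ωg) (hωf : 0 < ωf) (hτ : 0 < τ) (hσ : 0 < σ)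
    (hgs : ULPDA.StronglyConvex ωg g) (hfs : ULPDA.StronglyConvex ωf (ULPDA.conj f))
    (hθ : max (1 + 2 * ωg * τ)⁻¹ (1 + 2 * ωf * σ)⁻¹ ≤ θ) (hθ1 : θ < 1)
    (hstep : θ * σ * τ * ‖K‖ ^ 2 ≤ 1)
    (hlam : lam = σ / τ) (hlam' : lam' = (1 + 2 * ωg * τ) / (1 + 2 * ωf * σ) * lam) :
    -- two chains driven by the same noise
    (∀ {Ω : Type*} [MeasurableSpace Ω] (P : Measure Ω) [IsProbabilityMeasure P]
      (ξ X Xθ X' Xθ' : ℕ → Ω → EuclideanSpace ℝ (Fin d))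
      (Y Y' : ℕ → Ω → EuclideanSpace ℝ (Fin m)),
      ULPDA.IsChain K f g τ σ θ P ξ X Xθ Y → ULPDA.IsChain K f g τ σ θ P ξ X' Xθ' Y' →
      ∀ N : ℕ,
        ULPDA.W2 (P.map (X N)) (P.map (X' N)) ≤
          ENNReal.ofReal (θ ^ ((N : ℝ) / 2)) *
            ULPDA.T 1 lam'⁻¹ (P.map fun ω => (X 0 ω, Y 0 ω)) (P.map fun ω => (X' 0 ω, Y' 0 ω)) ∧
        (θ * σ * τ * ‖K‖ ^ 2 < 1 →
          ULPDA.T 1 lam'⁻¹ (P.map fun ω => (X N ω, Y N ω)) (P.map fun ω => (X' N ω, Y' N ω)) ≤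
            ENNReal.ofReal ((1 - θ * τ * σ * ‖K‖ ^ 2) ^ (-(1 / 2) : ℝ) * θ ^ ((N : ℝ) / 2)) *
              ULPDA.T 1 lam'⁻¹ (P.map fun ω => (X 0 ω, Y 0 ω))
                (P.map fun ω => (X' 0 ω, Y' 0 ω)))) ∧
    -- existence of a stationary distribution, and convergence to it
    (θ * σ * τ * ‖K‖ ^ 2 < 1 →
      ∃ S : Measure (EuclideanSpace ℝ (Fin d) × EuclideanSpace ℝ (Fin d) ×
          EuclideanSpace ℝ (Fin m)),
        ULPDA.IsStationary K f g τ σ θ S ∧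
        MemLp id 2 (S.map fun s => (s.1, s.2.2)) ∧
        ∀ {Ω : Type*} [MeasurableSpace Ω] (P : Measure Ω) [IsProbabilityMeasure P]
          (ξ X Xθ : ℕ → Ω → EuclideanSpace ℝ (Fin d)) (Y : ℕ → Ω → EuclideanSpace ℝ (Fin m)),
          ULPDA.IsChain K f g τ σ θ P ξ X Xθ Y →
          MemLp id 2 (P.map fun ω => (X 0 ω, Y 0 ω)) →
          Tendsto
            (fun N : ℕ => ULPDA.T 1 lam'⁻¹ (P.map fun ω => (X N ω, Y N ω))
              (S.map fun s => (s.1, s.2.2)))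
            atTop (𝓝 0)) := by
  have hF : ULPDA.IsPotential (ULPDA.conj f) := hf.conj (hfs.mono hωf.le)
  have hA : 0 < 1 + 2 * ωg * τ := by positivity
  have hB : 0 < 1 + 2 * ωf * σ := by positivity
  have hθ0 : 0 < θ := (inv_pos.2 hA).trans_le ((le_max_left _ _).trans hθ)
  have hθg : τ⁻¹ ≤ θ * (τ⁻¹ + 2 * ωg) := by
    have h := (inv_le_iff_one_le_mul₀ hA).1 ((le_max_left _ _).trans hθ)
    calc τ⁻¹ ≤ θ * (1 + 2 * ωg * τ) * τ⁻¹ := le_mul_of_one_le_left (by positivity) h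
      _ = _ := by field_simp
  have hθf : σ⁻¹ ≤ θ * (σ⁻¹ + 2 * ωf) := by
    have h := (inv_le_iff_one_le_mul₀ hB).1 ((le_max_right _ _).trans hθ)
    calc σ⁻¹ ≤ θ * (1 + 2 * ωf * σ) * σ⁻¹ := le_mul_of_one_le_left (by positivity) h
      _ = _ := by field_simp
  have ha : 0 < τ⁻¹ + 2 * ωg := by positivity
  have hb : 0 < σ⁻¹ + 2 * ωf := by positivity
  have hlam2 : lam'⁻¹ = (σ⁻¹ + 2 * ωf) / (τ⁻¹ + 2 * ωg) := by
    rw [hlam', hlam]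
    field_simp
  have hcontr := ULPDA.energy_step_sub_le hF hg hgs hfs hτ hσ hθ0 hθg hθf hstep
  have hq₁ : Measurable (AddMonoidHom.fst (EuclideanSpace ℝ (Fin d))
      (EuclideanSpace ℝ (Fin d) × EuclideanSpace ℝ (Fin m))) := measurable_fst
  have hq₂ : Measurable ((AddMonoidHom.fst (EuclideanSpace ℝ (Fin d))
      (EuclideanSpace ℝ (Fin d) × EuclideanSpace ℝ (Fin m))).prod
      ((AddMonoidHom.snd _ _).comp (AddMonoidHom.snd _ _))) :=
    measurable_fst.prodMk (measurable_snd.comp measurable_snd)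
  have hdom : ∀ s : EuclideanSpace ℝ (Fin d) × EuclideanSpace ℝ (Fin d) ×
      EuclideanSpace ℝ (Fin m), (1 - θ * σ * τ * ‖K‖ ^ 2) * (τ⁻¹ + 2 * ωg) *
      ULPDA.weightedNorm 1 lam'⁻¹ (s.1, s.2.2) ^ 2 ≤ ULPDA.energy K ωg ωf τ σ θ s := by
    intro s
    refine le_trans (le_of_eq ?_) (ULPDA.mul_le_energy hωg hτ hσ hθ0 hθf s)
    rw [hlam2, ULPDA.sq_weightedNorm zero_le_one (by positivity), mul_assoc]
    congr 1
    field_simp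
  refine ⟨fun P _ ξ X Xθ X' Xθ' Y Y' h h' N => ⟨?_, fun hlt => ?_⟩, fun hlt => ?_⟩
  -- The `x`-part is dominated by the energy without loss, so `κ = 1` and the prefactor disappears.
  · have key := ULPDA.transportDist_chain_le hF hg hωg hωf hτ hσ hθ0 hcontr h h' hq₁
      (W := fun x => ‖x‖) one_pos (fun s => by
        rw [one_mul]
        exact ULPDA.mul_norm_fst_le_energy hωf hτ hσ hθ0 hθf hstep s) N
    rw [Real.one_rpow, one_mul, ← hlam2] at key
    exact key
  · have key := ULPDA.transportDist_chain_le hF hg hωg hωf hτ hσ hθ0 hcontr h h' hq₂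
      (sub_pos.2 hlt) hdom N
    rw [← hlam2, mul_right_comm θ σ τ] at key
    exact key
  · obtain ⟨L, hL⟩ := ULPDA.exists_lipschitzWith_step (K := K) (θ := θ) hF hg hτ hσ
    obtain ⟨c, hc, hcU⟩ := ULPDA.exists_mul_norm_sq_le_energy (K := K) hωg hωf hτ hσ hθ0 hθ1 hθf hlt
    obtain ⟨C, hC, hUC⟩ := ULPDA.exists_energy_le_mul_norm_sq (K := K) hωg hωf hτ hσ hθ0
    obtain ⟨S, hS, hinv, hmem⟩ := ULPDA.exists_stationary hL
      (IsGaussian.memLp_two_id (μ := stdGaussian (EuclideanSpace ℝ (Fin d))))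
      ULPDA.continuous_energy hc hC hθ0.le hθ1 hcU hUC hcontr
    refine ⟨S, ⟨hS, hinv⟩, ?_, ?_⟩
    · exact (memLp_map_measure_iff aestronglyMeasurable_id hq₂.aemeasurable).2
        (ULPDA.memLp_prodMk hmem.fst hmem.snd.snd)
    intro Ω _ P _ ξ X Xθ Y h hmem₀
    have hX := h.measurable_X_zero
    have hY := h.measurable_Y_zero
    have hdiag : Measurable fun z : EuclideanSpace ℝ (Fin d) × EuclideanSpace ℝ (Fin m) =>
      (z.1, z.1, z.2) := by fun_prop
    set π₀ := P.map fun ω => (X 0 ω, Y 0 ω) with hπ₀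
    have : IsProbabilityMeasure π₀ := Measure.isProbabilityMeasure_map (by fun_prop)
    set ρ := π₀.map fun z => (z.1, z.1, z.2) with hρ
    have : IsProbabilityMeasure ρ := Measure.isProbabilityMeasure_map hdiag.aemeasurable
    have hmemρ : MemLp id 2 ρ := by
      rw [memLp_map_measure_iff aestronglyMeasurable_id hdiag.aemeasurable]
      exact ULPDA.memLp_prodMk hmem₀.fst (ULPDA.memLp_prodMk hmem₀.fst hmem₀.snd)
    set J := ∫⁻ p, ENNReal.ofReal (ULPDA.energy K ωg ωf τ σ θ (p.1 - p.2)) ∂(ρ.prod S) with hJ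
    -- Both laws have second moments, so even the independent coupling has finite energy; the bound
    -- then decays like `θ ^ (N / 2)`.
    have hJtop : J < ∞ :=
      ULPDA.lintegral_ofReal_comp_lt_top hC.le hUC ((hmemρ.comp_fst S).sub (hmem.comp_snd ρ))
    set κ := (1 - θ * σ * τ * ‖K‖ ^ 2) * (τ⁻¹ + 2 * ωg)
    have hκ : 0 < κ := mul_pos (sub_pos.2 hlt) ha
    have hbound : ∀ N, ULPDA.T 1 lam'⁻¹ (P.map fun ω => (X N ω, Y N ω))
        (S.map fun s => (s.1, s.2.2)) ≤ (ENNReal.ofReal (κ⁻¹ * θ ^ N) * J) ^ (1 / 2 : ℝ) := by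
      intro N
      obtain ⟨hm, hlaw⟩ := h.map_state hF hg hτ hσ N
      have key := ULPDA.transportDist_evolve_le hL.continuous.measurable
        (ULPDA.continuous_energy.measurable) hθ0.le hcontr (ULPDA.isCoupling_prod ρ S) hq₂ hκ
        (γ := stdGaussian (EuclideanSpace ℝ (Fin d))) hdom N
      rw [Function.iterate_fixed hinv, ← hlaw, Measure.map_map hq₂ hm] at key
      exact key
    refine tendsto_of_tendsto_of_tendsto_of_le_of_le tendsto_const_nhds ?_ (fun _ => zero_le)
      hbound
    have h1 : Tendsto (fun N : ℕ => ENNReal.ofReal (κ⁻¹ * θ ^ N) * J) atTop (𝓝 0) := by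
      have h2 := (tendsto_pow_atTop_nhds_zero_of_lt_one hθ0.le hθ1).const_mul κ⁻¹
      have h3 := ENNReal.Tendsto.mul_const (ENNReal.tendsto_ofReal h2) (Or.inr hJtop.ne)
      simpa using h3
    have h4 := ((ENNReal.continuous_rpow_const (y := 1 / 2)).tendsto 0).comp h1
    rwa [ENNReal.zero_rpow_of_pos (by norm_num)] at h4
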